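/- Let $\Bbbk$ be a field. A noncommutative Novikov algebra is a $\Bbbk$-vector space with two bilinear operations $\prec,\succ$ satisfying $$a\succ(b\prec c)=(a\succ b)\prec c,\qquad (a\prec b)\succ c-a\succ(b\succ c)=a\prec(b\succ c)-(a\prec b)\prec c .$$ For a set $X$ let $\textrm{N-Nov}\langle X\rangle$ be the free noncommutative Novikov algebra on $X$. A monomial in $X$ is a planar binary tree whose inner vertices are labelled by $\prec$ or $\succ$ and whose leaves are labelled by elements of $X$; it represents an element of $\textrm{N-Nov}\langle X\rangle$. Consider words $u=x^{(n_1)}\cdots x^{(n_k)}$ ($n_i\ge 0$, $x=x^{(0)}$) in the derivatives of one letter $x$, with weight $\mathrm{wt}(u)=\sum_i (n_i-1)$, and let $U$ be the set of all words of weight $-1$. The standard bracketing $[u]$ of $u\in U$ is the following tree with $k$ leaves marked by $x$. (i) If $u=x^{p}\,x^{(m)}\,x^{m-p}$ with $0\le p\le m$ (where $x^p$ is the $p$-fold product $x\cdots x$), then $$[u]=\underbrace{x\prec(x\prec\cdots\prec(x}_{p}\prec((\cdots(x\succ \underbrace{x)\succ\cdots)\succ x}_{m-p})\,)\cdots).$$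 (ii) Otherwise $u$ has proper (contiguous) subwords of length $>1$ and weight $-1$. Among those of them that contain no smaller subword of this kind let $v$ be the leftmost one, $u=u_1vu_2$; then $[u]$ is obtained from $[u_1xu_2]$ by substituting $[v]$ for the leaf in the position of the letter $x$ that replaced $v$. Let $[U]=\{[u] : u\in U\}$. Then for every set $X$ the monomials obtained from the trees of $[U]$ by labelling the leaves with elements of $X$ in all possible ways form a basis of $\textrm{N-Nov}\langle X\rangle$: distinct labelled trees represent linearly independent (in particular distinct) elements, and these elements span $\textrm{N-Nov}\langle X\rangle$. -/

import Mathlib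

universe u v w

/-- A noncommutative Novikov algebra over `𝕜`: a `𝕜`-module with two bilinear operations
`a ≺ b = prec a b` and `a ≻ b = succ a b` such that `a ≻ (b ≺ c) = (a ≻ b) ≺ c` and
`(a ≺ b) ≻ c - a ≻ (b ≻ c) = a ≺ (b ≻ c) - (a ≺ b) ≺ c`. -/
class NNovAlgebra (𝕜 : Type u) (A : Type v) [CommRing 𝕜] [AddCommGroup A] [Module 𝕜 A] where
  prec : A →ₗ[𝕜] A →ₗ[𝕜] A
  succ : A →ₗ[𝕜] A →ₗ[𝕜] A
  succ_prec : ∀ a b c : A, succ a (prec b c) = prec (succ a b) c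
  prec_succ : ∀ a b c : A,
    succ (prec a b) c - succ a (succ b c) = prec a (succ b c) - prec (prec a b) c

/-- Planar binary trees whose inner vertices are labelled by `≺` or `≻` and whose leaves are
labelled by elements of `X`, i.e. nonassociative monomials in `X` with two operations. -/
inductive OpTree (X : Type u) : Type u
  | leaf : X → OpTree X
  | prec : OpTree X → OpTree X → OpTree X
  | succ : OpTree X → OpTree X → OpTree X

namespace OpTree

/-- Number of leaves. -/
def numLeaves {X : Type u} : OpTree X → ℕ
  | leaf _ => 1
  | prec l r => numLeaves l + numLeaves r
  | succ l r => numLeaves l + numLeaves r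

/-- Relabelling of the leaves. -/
def map {X : Type u} {Y : Type v} (f : X → Y) : OpTree X → OpTree Y
  | leaf x => leaf (f x)
  | prec l r => prec (map f l) (map f r)
  | succ l r => succ (map f l) (map f r)

/-- The basic tree of a monomial: forget the labels of the leaves. -/
def shape {X : Type u} (t : OpTree X) : OpTree Unit := t.map fun _ => ()

/-- `graft t i s` substitutes `s` for the leaf of `t` in position `i`, the leaves being numbered
from left to right starting with `0`. -/
def graft {X : Type u} : OpTree X → ℕ → OpTree X → OpTree X
  | leaf x, i, s => if i = 0 then s else leaf x
  | prec l r, i, s =>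
      if i < l.numLeaves then prec (graft l i s) r else prec l (graft r (i - l.numLeaves) s)
  | succ l r, i, s =>
      if i < l.numLeaves then succ (graft l i s) r else succ l (graft r (i - l.numLeaves) s)

/-- The value of a monomial in an algebra with two operations. -/
def eval (𝕜 : Type w) {X : Type u} {A : Type v} [CommRing 𝕜] [AddCommGroup A] [Module 𝕜 A]
    [NNovAlgebra 𝕜 A] (f : X → A) : OpTree X → A
  | leaf x => f x
  | prec l r => NNovAlgebra.prec (𝕜 := 𝕜) (eval 𝕜 f l) (eval 𝕜 f r)
  | succ l r => NNovAlgebra.succ (𝕜 := 𝕜) (eval 𝕜 f l) (eval 𝕜 f r)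

end OpTree

noncomputable section

/-! ### The free noncommutative Novikov algebra -/

/-- The bilinear extension of `≺` to linear combinations of trees. -/
def treePrec (𝕜 : Type u) (X : Type v) [CommRing 𝕜] :
    (OpTree X →₀ 𝕜) →ₗ[𝕜] (OpTree X →₀ 𝕜) →ₗ[𝕜] (OpTree X →₀ 𝕜) :=
  Finsupp.linearCombination 𝕜 fun s => Finsupp.lmapDomain 𝕜 𝕜 fun t => OpTree.prec s t

/-- The bilinear extension of `≻` to linear combinations of trees. -/
def treeSucc (𝕜 : Type u) (X : Type v) [CommRing 𝕜] :
    (OpTree X →₀ 𝕜) →ₗ[𝕜] (OpTree X →₀ 𝕜) →ₗ[𝕜] (OpTree X →₀ 𝕜) :=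
  Finsupp.linearCombination 𝕜 fun s => Finsupp.lmapDomain 𝕜 𝕜 fun t => OpTree.succ s t

/-- `I` is a two-sided ideal (for both operations) containing all values of the two defining
identities. -/
structure IsNNovIdeal {𝕜 : Type u} {X : Type v} [CommRing 𝕜]
    (I : Submodule 𝕜 (OpTree X →₀ 𝕜)) : Prop where
  succ_prec : ∀ a b c, treeSucc 𝕜 X a (treePrec 𝕜 X b c) - treePrec 𝕜 X (treeSucc 𝕜 X a b) c ∈ I
  prec_succ : ∀ a b c,
    (treeSucc 𝕜 X (treePrec 𝕜 X a b) c - treeSucc 𝕜 X a (treeSucc 𝕜 X b c)) -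
      (treePrec 𝕜 X a (treeSucc 𝕜 X b c) - treePrec 𝕜 X (treePrec 𝕜 X a b) c) ∈ I
  prec_left : ∀ a, ∀ b ∈ I, treePrec 𝕜 X a b ∈ I
  prec_right : ∀ a ∈ I, ∀ b, treePrec 𝕜 X a b ∈ I
  succ_left : ∀ a, ∀ b ∈ I, treeSucc 𝕜 X a b ∈ I
  succ_right : ∀ a ∈ I, ∀ b, treeSucc 𝕜 X a b ∈ I

/-- The ideal generated by the two defining identities. -/
def nnovIdeal (𝕜 : Type u) (X : Type v) [CommRing 𝕜] : Submodule 𝕜 (OpTree X →₀ 𝕜) :=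
  sInf {I | IsNNovIdeal I}

theorem isNNovIdeal_nnovIdeal (𝕜 : Type u) (X : Type v) [CommRing 𝕜] :
    IsNNovIdeal (nnovIdeal 𝕜 X) where
  succ_prec a b c := (Submodule.mem_sInf).2 fun _ hI => IsNNovIdeal.succ_prec hI a b c
  prec_succ a b c := (Submodule.mem_sInf).2 fun _ hI => IsNNovIdeal.prec_succ hI a b c
  prec_left a b hb := (Submodule.mem_sInf).2 fun I hI =>
    IsNNovIdeal.prec_left hI a b ((Submodule.mem_sInf).1 hb I hI)
  prec_right a ha b := (Submodule.mem_sInf).2 fun I hI =>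
    IsNNovIdeal.prec_right hI a ((Submodule.mem_sInf).1 ha I hI) b
  succ_left a b hb := (Submodule.mem_sInf).2 fun I hI =>
    IsNNovIdeal.succ_left hI a b ((Submodule.mem_sInf).1 hb I hI)
  succ_right a ha b := (Submodule.mem_sInf).2 fun I hI =>
    IsNNovIdeal.succ_right hI a ((Submodule.mem_sInf).1 ha I hI) b

/-- The free noncommutative Novikov algebra on the set `X`: the free algebra with two bilinear
operations modulo the ideal generated by the defining identities. -/
abbrev FreeNNov (𝕜 : Type u) (X : Type v) [CommRing 𝕜] : Type (max u v) :=
  (OpTree X →₀ 𝕜) ⧸ nnovIdeal 𝕜 X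

/-- A bilinear map that preserves a submodule on both sides descends to the quotient. -/
def quotBilin {𝕜 : Type u} {M : Type v} [CommRing 𝕜] [AddCommGroup M] [Module 𝕜 M]
    (I : Submodule 𝕜 M) (m : M →ₗ[𝕜] M →ₗ[𝕜] M) (hl : ∀ a, ∀ b ∈ I, m a b ∈ I)
    (hr : ∀ a ∈ I, ∀ b, m a b ∈ I) : (M ⧸ I) →ₗ[𝕜] (M ⧸ I) →ₗ[𝕜] (M ⧸ I) :=
  I.liftQ
    { toFun := fun a => I.mapQ I (m a) fun b hb => hl a b hb
      map_add' := fun a a' => by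
        ext b
        simp
      map_smul' := fun r a => by
        ext b
        simp }
    (fun a ha => by
      rw [LinearMap.mem_ker]
      ext b
      simpa using (Submodule.Quotient.mk_eq_zero I).2 (hr a ha b))

instance FreeNNov.instNNovAlgebra (𝕜 : Type u) (X : Type v) [CommRing 𝕜] :
    NNovAlgebra 𝕜 (FreeNNov 𝕜 X) where
  prec := quotBilin (nnovIdeal 𝕜 X) (treePrec 𝕜 X) (isNNovIdeal_nnovIdeal 𝕜 X).prec_left
    (isNNovIdeal_nnovIdeal 𝕜 X).prec_right
  succ := quotBilin (nnovIdeal 𝕜 X) (treeSucc 𝕜 X) (isNNovIdeal_nnovIdeal 𝕜 X).succ_left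
    (isNNovIdeal_nnovIdeal 𝕜 X).succ_right
  succ_prec a b c := by
    induction a using Submodule.Quotient.induction_on with | _ a => ?_
    induction b using Submodule.Quotient.induction_on with | _ b => ?_
    induction c using Submodule.Quotient.induction_on with | _ c => ?_
    exact (Submodule.Quotient.eq _).2 ((isNNovIdeal_nnovIdeal 𝕜 X).succ_prec a b c)
  prec_succ a b c := by
    induction a using Submodule.Quotient.induction_on with | _ a => ?_
    induction b using Submodule.Quotient.induction_on with | _ b => ?_
    induction c using Submodule.Quotient.induction_on with | _ c => ?_
    exact (Submodule.Quotient.eq _).2 ((isNNovIdeal_nnovIdeal 𝕜 X).prec_succ a b c)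

/-- The generators of the free noncommutative Novikov algebra. -/
def FreeNNov.of (𝕜 : Type u) {X : Type v} [CommRing 𝕜] (x : X) : FreeNNov 𝕜 X :=
  Submodule.Quotient.mk (Finsupp.single (OpTree.leaf x) 1)

/-- The element of the free noncommutative Novikov algebra represented by a monomial. -/
def FreeNNov.monomial (𝕜 : Type u) {X : Type v} [CommRing 𝕜] (t : OpTree X) : FreeNNov 𝕜 X :=
  t.eval 𝕜 (FreeNNov.of 𝕜)

theorem FreeNNov.mk_tree (𝕜 : Type u) {X : Type v} [CommRing 𝕜] (t : OpTree X) :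
    (Submodule.Quotient.mk (Finsupp.single t 1) : FreeNNov 𝕜 X) = t.eval 𝕜 (FreeNNov.of 𝕜) := by
  induction t with
  | leaf x => rfl
  | prec s t hs ht =>
    simp only [OpTree.eval, ← hs, ← ht]
    change _ = Submodule.Quotient.mk (treePrec 𝕜 X (Finsupp.single s 1) (Finsupp.single t 1))
    simp [treePrec]
  | succ s t hs ht =>
    simp only [OpTree.eval, ← hs, ← ht]
    change _ = Submodule.Quotient.mk (treeSucc 𝕜 X (Finsupp.single s 1) (Finsupp.single t 1))
    simp [treeSucc]

/-- The universal property: every map from `X` to a noncommutative Novikov algebra extends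
uniquely to a homomorphism from `FreeNNov 𝕜 X`. -/
theorem FreeNNov.existsUnique_hom (𝕜 : Type u) {X : Type v} {A : Type w} [CommRing 𝕜]
    [AddCommGroup A] [Module 𝕜 A] [NNovAlgebra 𝕜 A] (f : X → A) :
    ∃! φ : FreeNNov 𝕜 X →ₗ[𝕜] A, (∀ x, φ (FreeNNov.of 𝕜 x) = f x) ∧
      (∀ a b, φ (NNovAlgebra.prec (𝕜 := 𝕜) a b) = NNovAlgebra.prec (𝕜 := 𝕜) (φ a) (φ b)) ∧
      ∀ a b, φ (NNovAlgebra.succ (𝕜 := 𝕜) a b) = NNovAlgebra.succ (𝕜 := 𝕜) (φ a) (φ b) := by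
  let ψ : (OpTree X →₀ 𝕜) →ₗ[𝕜] A := Finsupp.linearCombination 𝕜 (OpTree.eval 𝕜 f)
  have hp : ∀ a b, ψ (treePrec 𝕜 X a b) = NNovAlgebra.prec (𝕜 := 𝕜) (ψ a) (ψ b) := by
    have : (treePrec 𝕜 X).compr₂ ψ = (NNovAlgebra.prec (𝕜 := 𝕜) (A := A)).compl₁₂ ψ ψ := by
      ext s t
      simp [ψ, treePrec, OpTree.eval]
    exact fun a b => LinearMap.congr_fun₂ this a b
  have hs : ∀ a b, ψ (treeSucc 𝕜 X a b) = NNovAlgebra.succ (𝕜 := 𝕜) (ψ a) (ψ b) := by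
    have : (treeSucc 𝕜 X).compr₂ ψ = (NNovAlgebra.succ (𝕜 := 𝕜) (A := A)).compl₁₂ ψ ψ := by
      ext s t
      simp [ψ, treeSucc, OpTree.eval]
    exact fun a b => LinearMap.congr_fun₂ this a b
  have hker : IsNNovIdeal (LinearMap.ker ψ) := by
    constructor <;> intro a b
    · intro c
      simp [hp, hs, NNovAlgebra.succ_prec]
    · intro c
      simp [hp, hs, NNovAlgebra.prec_succ]
    all_goals
      intros
      simp_all
  refine ⟨(nnovIdeal 𝕜 X).liftQ ψ (sInf_le hker), ⟨fun x => ?_, fun a b => ?_, fun a b => ?_⟩, ?_⟩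
  · change ψ (Finsupp.single (OpTree.leaf x) 1) = f x
    simp [ψ, OpTree.eval]
  · induction a using Submodule.Quotient.induction_on with | _ a => ?_
    induction b using Submodule.Quotient.induction_on with | _ b => ?_
    exact hp a b
  · induction a using Submodule.Quotient.induction_on with | _ a => ?_
    induction b using Submodule.Quotient.induction_on with | _ b => ?_
    exact hs a b
  · rintro φ ⟨h1, h2, h3⟩
    have key : ∀ t : OpTree X, φ (t.eval 𝕜 (FreeNNov.of 𝕜)) = t.eval 𝕜 f := by
      intro t
      induction t with
      | leaf x => exact h1 x
      | prec s t ihs iht => simp only [OpTree.eval, h2, ihs, iht]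
      | succ s t ihs iht => simp only [OpTree.eval, h3, ihs, iht]
    apply Submodule.linearMap_qext
    ext t
    change φ (Submodule.Quotient.mk (Finsupp.single t 1)) = ψ (Finsupp.single t 1)
    rw [FreeNNov.mk_tree, key]
    simp [ψ]

end

/-! ### Words of weight `-1` and their standard bracketings -/

namespace DiffWord

/-- The list `[n₁, …, n_k]` stands for the word `x^(n₁) ⋯ x^(n_k)` in the free associative algebra
with derivation on one generator `x`. The weight is additive and `x^(n)` has weight `n - 1`. -/
def wt : List ℕ → ℤ
  | [] => 0
  | n :: u => ((n : ℤ) - 1) + wt u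

/-- The word `x^p x^(k) x^(k-p)`. -/
def baseWord (k p : ℕ) : List ℕ :=
  List.replicate p 0 ++ [k] ++ List.replicate (k - p) 0

/-- The tree `x ≺ (x ≺ ⋯ (x ≺ ((⋯ (x ≻ x) ≻ ⋯) ≻ x)))` with `p` symbols `≺` and `k - p`
symbols `≻`. -/
def baseTree (k p : ℕ) : OpTree Unit :=
  (fun t => OpTree.prec (OpTree.leaf ()) t)^[p]
    ((fun t => OpTree.succ t (OpTree.leaf ()))^[k - p] (OpTree.leaf ()))

/-- The subword of `u` of length `l` starting after the first `i` letters. -/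
def subword (u : List ℕ) (l i : ℕ) : List ℕ := (u.drop i).take l

/-- `u` has a proper subword of length `l > 1` and weight `-1` that starts after `i` letters. -/
abbrev HasSub (u : List ℕ) (i l : ℕ) : Prop :=
  1 < l ∧ l < u.length ∧ i + l ≤ u.length ∧ wt (subword u l i) = -1

/-- The subword of length `l` that starts after `i` letters is a shortest one: it is a proper
subword of `u` of length `> 1` and weight `-1`, and no other such subword is contained in it.
(The bounds on `i'` and `l'` follow from `HasSub u i' l'`.) -/
def IsShortest (u : List ℕ) (i l : ℕ) : Prop :=
  HasSub u i l ∧ ∀ i' < u.length, ∀ l' < u.length,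
    HasSub u i' l' ∧ i ≤ i' ∧ i' + l' ≤ i + l → i' = i ∧ l' = l

instance (u : List ℕ) (i l : ℕ) : Decidable (IsShortest u i l) := by
  unfold IsShortest
  infer_instance

/-- Some shortest subword of `u` starts after `i` letters. (Its length is unique.) -/
def ShortestStart (u : List ℕ) (i : ℕ) : Prop := ∃ l < u.length, IsShortest u i l

instance (u : List ℕ) (i : ℕ) : Decidable (ShortestStart u i) := by
  unfold ShortestStart
  infer_instance

/-- The standard bracketing `[u]` of a word `u` of weight `-1`. A word `x^p x^(k) x^(k-p)` is
bracketed as `baseTree k p`. Otherwise let `v` be the leftmost of the proper subwords of length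
`> 1` and weight `-1` that contain no other such subword, so that `u = u₁ v u₂`;
`[u]` is obtained by substituting `[v]` for the corresponding leaf of `[u₁ x u₂]`.
(The last branch is not reached by a word of weight `-1`.) -/
def bracket (u : List ℕ) : OpTree Unit :=
  if u = baseWord (u.length - 1) (u.findIdx (· = u.length - 1)) then
    baseTree (u.length - 1) (u.findIdx (· = u.length - 1))
  else if h : ∃ i < u.length, ShortestStart u i then
    have h' : ∃ i, ShortestStart u i := h.imp fun _ hi => hi.2
    let i := Nat.find h'
    let l := Nat.find (Nat.find_spec h')
    (bracket (u.take i ++ [0] ++ u.drop (i + l))).graft i (bracket (subword u l i))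
  else OpTree.leaf ()
termination_by u.length
decreasing_by
  all_goals
    have hs := (Nat.find_spec (Nat.find_spec h')).2.1
    obtain ⟨h1, h2, h3, -⟩ := hs
    simp only [subword, List.length_append, List.length_take, List.length_drop, List.length_cons,
      List.length_nil]
    omega

/-- The set `[U]` of the standard bracketings of all words of weight `-1`. -/
def bracketSet : Set (OpTree Unit) := {t | ∃ u : List ℕ, wt u = -1 ∧ bracket u = t}

end DiffWord

/-- All trees obtained from the trees of `[U]` by labelling the leaves with elements of `X`
in all possible ways. -/
def labelledBracketSet (X : Type u) : Set (OpTree X) := {t | t.shape ∈ DiffWord.bracketSet}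

/-! ### Weights of words and minimal subwords -/

namespace DiffWord

/-! Independence. A differential associative algebra becomes a noncommutative Novikov algebra by `a
≺ b = a d(b)`, `a ≻ b = d(a) b`, so every monomial has a value in the free differential algebra,
where distinct words are independent. It suffices that `[u]` takes the value `u` plus smaller words
(`diffEval_bracket_sub_mem`, `linearIndependent_of_leading`).

The difficulty is the order. The value `x x x'' + x x' x'` of `x ≺ (x ≺ x)` requires `x > x'` in
second position, while `x'' x x + x' x' x` requires `x'' > x'` in first position. Hence the order of
the next letter depends on the prefix `c` already read: with `g = topZeros c`, the letters up to `g`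
are ordered decreasingly and lie below the larger ones, which are ordered increasingly. Here `g`
counts the final zeros of a stack on which subwords of weight `-1` are contracted as soon as they
are complete. The contraction of `x^p x^(p+q) x^q` to `x` in the recursion for `[u]` does not alter
this stack, so the order is compatible with the recursion (`topZeros_append_bw`). The induction
allows arbitrary elements of a differential algebra as leaves, so that the value of a grafted tree
may occupy a leaf.

Spanning. Monomials are not rewritten into bracketings. Instead they are reduced to normal trees
(`eval_mem_treeSpan_isNormal`); the tool is `actions_succ_prec`, an identity satisfied
simultaneously by the operators `a ≻ ·` and `· ≺ a`. Normal trees with `k` leaves inject into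
balanced paths with `2(k - 1)` steps, and these into words of weight `-1` and length `k`. For a
fixed sequence of leaves the independent bracketings lie in the span of at most as many normal
trees, and comparing dimensions shows that the spans agree. -/

theorem wt_append (a b : List ℕ) : wt (a ++ b) = wt a + wt b := by
  induction a with
  | nil => simp [wt]
  | cons n a ih => simp [wt, ih, add_assoc]

theorem wt_replicate_zero (n : ℕ) : wt (List.replicate n 0) = -n := by
  induction n with
  | zero => simp [wt]
  | succ n ih => simp [List.replicate_succ, wt, ih]

theorem wt_eq_sum (u : List ℕ) : wt u = (u.sum : ℤ) - u.length := by
  induction u with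
  | nil => simp [wt]
  | cons n u ih => simp [wt, ih]; ring

/-- The base word `x^p x^(p+q) x^q`. -/
def bw (p q : ℕ) : List ℕ := List.replicate p 0 ++ (p + q) :: List.replicate q 0

theorem baseWord_eq_bw (p q : ℕ) : baseWord (p + q) p = bw p q := by
  simp [baseWord, bw]

theorem length_bw (p q : ℕ) : (bw p q).length = p + q + 1 := by
  simp [bw]; ring

theorem wt_bw (p q : ℕ) : wt (bw p q) = -1 := by
  simp only [bw, wt_append, wt_replicate_zero, wt]
  push_cast
  ring

/-- No subword of length greater than one has weight `-1`. -/
def NoSub (w : List ℕ) : Prop := ∀ a b c, w = a ++ b ++ c → 1 < b.length → wt b ≠ -1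

/-- A letter lowers the weight by at most one, so partial sums that descend to `-1` or below hit
`-1` exactly. -/
theorem exists_prefix_wt (r : List ℕ) (h : ℤ) (h0 : 0 ≤ h) (hr : h + wt r ≤ -1) :
    ∃ s t, r = s ++ t ∧ h + wt s = -1 := by
  induction r generalizing h with
  | nil => simp [wt] at hr; omega
  | cons n r ih =>
    by_cases hn : h + ((n : ℤ) - 1) ≤ -1
    · exact ⟨[n], r, rfl, by simp [wt]; omega⟩
    · obtain ⟨s, t, rfl, hs⟩ := ih (h + ((n : ℤ) - 1)) (by omega) (by simp [wt] at hr; omega)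
      exact ⟨n :: s, t, rfl, by simp [wt]; omega⟩

theorem eq_replicate_or_cons (u : List ℕ) :
    (∃ n, u = List.replicate n 0) ∨ ∃ p m r, 0 < m ∧ u = List.replicate p 0 ++ m :: r := by
  induction u with
  | nil => exact .inl ⟨0, rfl⟩
  | cons n u ih =>
    rcases Nat.eq_zero_or_pos n with rfl | hn
    · rcases ih with ⟨k, rfl⟩ | ⟨p, m, r, hm, rfl⟩
      · exact .inl ⟨k + 1, by simp [List.replicate_succ]⟩
      · exact .inr ⟨p + 1, m, r, hm, by simp [List.replicate_succ]⟩
    · exact .inr ⟨0, n, u, hn, by simp⟩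

theorem eq_replicate_or_concat (u : List ℕ) :
    (∃ n, u = List.replicate n 0) ∨ ∃ r m q, 0 < m ∧ u = r ++ m :: List.replicate q 0 := by
  rcases eq_replicate_or_cons u.reverse with ⟨n, h⟩ | ⟨p, m, r, hm, h⟩
  · refine .inl ⟨n, ?_⟩
    rw [← List.reverse_reverse u, h, List.reverse_replicate]
  · refine .inr ⟨r.reverse, m, p, hm, ?_⟩
    rw [← List.reverse_reverse u, h]
    simp

/-- A word of weight `-1` all of whose proper subwords of weight `-1` are letters is a base
word. -/
theorem eq_bw_of_minimal (u : List ℕ) (hu : wt u = -1)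
    (hmin : ∀ a b c, u = a ++ b ++ c → 1 < b.length → b.length < u.length → wt b ≠ -1) :
    ∃ p q, u = bw p q := by
  rcases eq_replicate_or_cons u with ⟨n, rfl⟩ | ⟨p, m, r, hm, rfl⟩
  · rw [wt_replicate_zero] at hu
    obtain rfl : n = 1 := by omega
    exact ⟨0, 0, rfl⟩
  rcases eq_replicate_or_concat r with ⟨q, rfl⟩ | ⟨r, m', q, hm', rfl⟩
  · simp [wt_append, wt_replicate_zero, wt] at hu
    refine ⟨p, q, ?_⟩
    rw [bw, show m = p + q by omega]
  exfalso
  -- Otherwise `x^m x^(m)` is a subword of weight `-1`, proper because of the second nonzero letter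
  -- `m'`. The bound `q < m'` is symmetric.
  have hp : p < m := by
    by_contra hp
    push Not at hp
    obtain ⟨k, rfl⟩ := Nat.exists_eq_add_of_le' hp
    refine hmin (List.replicate k 0) (List.replicate m 0 ++ [m]) (r ++ m' :: List.replicate q 0)
      ?_ ?_ ?_ ?_
    · rw [List.replicate_add]; simp only [List.append_assoc, List.cons_append, List.nil_append]
    · simp; omega
    · simp; omega
    · simp only [wt_append, wt_replicate_zero, wt]; ring
  have hq : q < m' := by
    by_contra hq
    push Not at hq
    obtain ⟨k, rfl⟩ := Nat.exists_eq_add_of_le hq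
    refine hmin (List.replicate p 0 ++ m :: r) (m' :: List.replicate m' 0) (List.replicate k 0)
      ?_ ?_ ?_ ?_
    · rw [List.replicate_add]; simp only [List.append_assoc, List.cons_append]
    · simp; omega
    · simp; omega
    · simp only [wt_replicate_zero, wt]; ring
  simp only [wt_append, wt_replicate_zero, wt] at hu
  -- The height after the first nonzero letter is `m - 1 - p ≥ 0`, and the final block starting with
  -- `m'` has nonnegative weight, so the height `-1` is reached already inside `r`.
  obtain ⟨s, t, rfl, hs⟩ := exists_prefix_wt r ((m : ℤ) - 1 - p) (by omega) (by omega)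
  have hs1 : 0 < s.length := by
    rcases s with _ | ⟨n, s⟩
    · simp [wt] at hs; omega
    · simp
  refine hmin [] (List.replicate p 0 ++ m :: s) (t ++ m' :: List.replicate q 0) ?_ ?_ ?_ ?_
  · simp
  · simp; omega
  · simp; omega
  · simp only [wt_append, wt_replicate_zero, wt]; omega

theorem hasSub_iff (u : List ℕ) (i l : ℕ) : HasSub u i l ↔
    1 < l ∧ l < u.length ∧ ∃ a b c, u = a ++ b ++ c ∧ a.length = i ∧ b.length = l ∧ wt b = -1 := by
  constructor
  · rintro ⟨h1, h2, h3, h4⟩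
    refine ⟨h1, h2, u.take i, subword u l i, u.drop (i + l), ?_, ?_, ?_, h4⟩
    · simp [subword, ← List.drop_drop]
    · simp; omega
    · simp [subword]; omega
  · rintro ⟨h1, h2, a, b, c, rfl, rfl, rfl, h⟩
    refine ⟨h1, h2, by simp, ?_⟩
    simpa [subword] using h

theorem findIdx_bw (p q : ℕ) : (bw p q).findIdx (· = (bw p q).length - 1) = p := by
  rw [length_bw, Nat.add_sub_cancel, bw]
  rcases Nat.eq_zero_or_pos (p + q) with h | h
  · obtain ⟨rfl, rfl⟩ : p = 0 ∧ q = 0 := by omega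
    simp [List.findIdx_cons]
  · rw [List.findIdx_append, List.findIdx_eq_length_of_false]
    · simp [List.findIdx_cons]
    · intro x hx
      rw [List.eq_of_mem_replicate hx]
      simpa using h.ne

theorem bracket_bw (p q : ℕ) : bracket (bw p q) = baseTree (p + q) p := by
  have h : bw p q = baseWord ((bw p q).length - 1)
      ((bw p q).findIdx (· = (bw p q).length - 1)) := by
    rw [findIdx_bw, length_bw, Nat.add_sub_cancel, baseWord_eq_bw]
  rw [bracket, if_pos h, findIdx_bw, length_bw, Nat.add_sub_cancel]

theorem HasSub.exists_isShortest {u : List ℕ} {i l : ℕ} (h : HasSub u i l) :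
    ∃ i' l', IsShortest u i' l' ∧ i ≤ i' ∧ i' + l' ≤ i + l := by
  classical
  induction l using Nat.strong_induction_on generalizing i with
  | _ l ih =>
    by_cases hs : IsShortest u i l
    · exact ⟨i, l, hs, le_rfl, le_rfl⟩
    · simp only [IsShortest, not_and, not_forall] at hs
      obtain ⟨i', -, l', -, ⟨h', h1, h2⟩, h3⟩ := hs h
      obtain ⟨i'', l'', h4, h5, h6⟩ := ih l' (by omega) h'
      exact ⟨i'', l'', h4, by omega, by omega⟩

/-- Minimality inside `u` is inherited by the subword as a word of its own, so `eq_bw_of_minimal`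
applies. -/
theorem IsShortest.eq_bw {u : List ℕ} {i l : ℕ} (h : IsShortest u i l) :
    ∃ p q, subword u l i = bw p q := by
  obtain ⟨⟨h1, h2, h3, h4⟩, h5⟩ := h
  have hl : (subword u l i).length = l := by simp [subword]; omega
  refine eq_bw_of_minimal _ h4 fun a b c habc hb hb' hwt => ?_
  have hlen := congrArg List.length habc
  simp only [hl, List.length_append] at hlen
  rw [hl] at hb'
  have hu : u = (u.take i ++ a) ++ b ++ (c ++ u.drop (i + l)) := by
    have : u = u.take i ++ (subword u l i ++ u.drop (i + l)) := by simp [subword, ← List.drop_drop]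
    rw [habc] at this
    simpa using this
  have hta : (u.take i ++ a).length = i + a.length := by simp; omega
  have := h5 (i + a.length) (by omega) b.length (by omega)
    ⟨(hasSub_iff _ _ _).2 ⟨hb, by omega, _, _, _, hu, hta, rfl, hwt⟩, by omega, by omega⟩
  omega

theorem eq_bw_of_eq_baseWord {u : List ℕ} (hu : wt u = -1) {p : ℕ}
    (h : u = baseWord (u.length - 1) p) : ∃ p q, u = bw p q := by
  have hlen := congrArg List.length h
  have h0 : 0 < u.length := by
    rcases u with _ | ⟨n, u⟩
    · simp [wt] at hu
    · simp
  simp only [baseWord, List.length_append, List.length_replicate, List.length_singleton] at hlen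
  obtain ⟨q, hq⟩ := Nat.exists_eq_add_of_le (show p ≤ u.length - 1 by omega)
  rw [hq, baseWord_eq_bw] at h
  exact ⟨p, q, h⟩

/-- The recursive description of the standard bracketing. -/
theorem bracket_cases (u : List ℕ) (hu : wt u = -1) :
    (∃ p q, u = bw p q) ∨
    ∃ u₁ p q u₂, u = u₁ ++ bw p q ++ u₂ ∧ 0 < p + q ∧
      bracket u = (bracket (u₁ ++ 0 :: u₂)).graft u₁.length (baseTree (p + q) p) ∧
      NoSub (u₁ ++ (bw p q).dropLast) := by
  by_cases hb : ∃ p q, u = bw p q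
  · exact .inl hb
  right
  have hne : u ≠ baseWord (u.length - 1) (u.findIdx (· = u.length - 1)) :=
    fun h => hb (eq_bw_of_eq_baseWord hu h)
  have hex : ∃ i < u.length, ShortestStart u i := by
    by_contra hcon
    refine hb (eq_bw_of_minimal u hu fun a b c habc hb1 hb2 hwt => hcon ?_)
    obtain ⟨i, l, h, -, -⟩ := HasSub.exists_isShortest
      ((hasSub_iff u a.length b.length).2 ⟨hb1, hb2, a, b, c, habc, rfl, rfl, hwt⟩)
    obtain ⟨h1, h2, h3, -⟩ := h.1
    exact ⟨i, by omega, l, h2, h⟩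
  have h' : ∃ i, ShortestStart u i := hex.imp fun _ hi => hi.2
  have hbr : bracket u = (bracket (u.take (Nat.find h') ++ [0] ++
      u.drop (Nat.find h' + Nat.find (Nat.find_spec h')))).graft (Nat.find h')
        (bracket (subword u (Nat.find (Nat.find_spec h')) (Nat.find h'))) := by
    conv_lhs => rw [bracket]
    rw [if_neg hne, dif_pos hex]
  have hs := (Nat.find_spec (Nat.find_spec h')).2
  have hmin : ∀ j, ShortestStart u j → Nat.find h' ≤ j := fun j hj => Nat.find_min' h' hj
  generalize Nat.find (Nat.find_spec h') = l at *
  generalize Nat.find h' = i at *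
  obtain ⟨p, q, hpq⟩ := hs.eq_bw
  obtain ⟨h1, h2, h3, h4⟩ := hs.1
  have hlen : l = p + q + 1 := by
    rw [← length_bw, ← hpq]; simp [subword]; omega
  have hui : u = u.take i ++ bw p q ++ u.drop (i + l) := by
    rw [← hpq]; simp [subword, ← List.drop_drop]
  have hti : (u.take i).length = i := by simp; omega
  refine ⟨u.take i, p, q, u.drop (i + l), hui, by omega, ?_, fun a b c habc hb1 hwt => ?_⟩
  · rw [hbr, hpq, bracket_bw, hti]
    simp
  -- A subword of weight `-1` that ends before the last letter of `v` contains a shortest one. By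
  -- leftmostness this one starts no earlier than `v`, so it lies in `v` and equals `v`, which ends
  -- later.
  · have hlen' := congrArg List.length habc
    simp only [List.length_append, hti, List.length_dropLast, length_bw] at hlen'
    have hb0 : bw p q ≠ [] := by simp [bw]
    have hu' : u = a ++ b ++ (c ++ [(bw p q).getLast hb0] ++ u.drop (i + l)) := by
      calc u = u.take i ++ ((bw p q).dropLast ++ [(bw p q).getLast hb0]) ++ u.drop (i + l) := by
            rw [List.dropLast_append_getLast hb0]; exact hui
        _ = u.take i ++ (bw p q).dropLast ++ [(bw p q).getLast hb0] ++ u.drop (i + l) := by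
            simp only [List.append_assoc]
        _ = _ := by rw [habc]; simp only [List.append_assoc]
    obtain ⟨i', l', hs', h5, h6⟩ := HasSub.exists_isShortest
      ((hasSub_iff u a.length b.length).2 ⟨hb1, by omega, a, b, _, hu', rfl, rfl, hwt⟩)
    obtain ⟨h7, h8, h9, -⟩ := hs'.1
    have h10 := hmin i' ⟨l', h8, hs'⟩
    have := hs.2 i' (by omega) l' h8 ⟨hs'.1, h10, by omega⟩
    omega

/-! ### The contracting stack -/

/-- `push st n` appends the letter `n` to the stack `st` and, as long as the stack has a suffix
of weight `-1` and length greater than one, replaces the shortest such suffix by `0`. -/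
def push (st : List ℕ) (n : ℕ) : List ℕ :=
  if h : ∃ i, i < st.length ∧ wt (st.drop i ++ [n]) = -1 then
    push (st.take (Nat.findGreatest (fun i => i < st.length ∧ wt (st.drop i ++ [n]) = -1)
      st.length)) 0
  else st ++ [n]
termination_by st.length
decreasing_by
  obtain ⟨i, hi⟩ := h
  have := (Nat.findGreatest_spec (P := fun i => i < st.length ∧ wt (st.drop i ++ [n]) = -1)
    hi.1.le hi).1
  simpa using this

/-- The stack obtained by reading the word `w`. -/
def red (w : List ℕ) : List ℕ := w.foldl push []

/-- The number of zeros at the end of a word. -/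
def trail (w : List ℕ) : ℕ := (w.reverse.takeWhile (· = 0)).length

/-- The number of zeros at the end of the stack obtained by reading the word `w`. -/
def topZeros (w : List ℕ) : ℕ := trail (red w)

theorem red_concat (w : List ℕ) (n : ℕ) : red (w ++ [n]) = push (red w) n := by
  simp [red]

theorem red_append_congr {w w' : List ℕ} (h : red w = red w') (s : List ℕ) :
    red (w ++ s) = red (w' ++ s) := by
  simp only [red, List.foldl_append] at h ⊢
  rw [h]

theorem push_of_forall (st : List ℕ) (n : ℕ) (h : ∀ i < st.length, wt (st.drop i ++ [n]) ≠ -1) :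
    push st n = st ++ [n] := by
  rw [push, dif_neg]
  rintro ⟨i, hi, h'⟩
  exact h i hi h'

/-- Minimality of `b` makes `a.length` the greatest index whose suffix has weight `-1`, which is the
one `push` selects. -/
theorem push_of_suffix (a b : List ℕ) (n : ℕ) (hb : b ≠ []) (h : wt (b ++ [n]) = -1)
    (hmin : ∀ c d, b = c ++ d → c ≠ [] → d ≠ [] → wt (d ++ [n]) ≠ -1) :
    push (a ++ b) n = push a 0 := by
  have hb' : 0 < b.length := List.length_pos_iff.2 hb
  have ha : a.length < (a ++ b).length ∧ wt ((a ++ b).drop a.length ++ [n]) = -1 := by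
    simpa using ⟨hb', h⟩
  have hi : Nat.findGreatest (fun i => i < (a ++ b).length ∧ wt ((a ++ b).drop i ++ [n]) = -1)
      (a ++ b).length = a.length := by
    rw [Nat.findGreatest_eq_iff]
    refine ⟨by simp, fun _ => ha, ?_⟩
    rintro i hi - ⟨h1, h2⟩
    obtain ⟨k, rfl⟩ := Nat.exists_eq_add_of_le hi.le
    rw [List.drop_append, List.drop_eq_nil_of_le (by omega), Nat.add_sub_cancel_left,
      List.nil_append] at h2
    simp only [List.length_append] at h1
    refine hmin (b.take k) (b.drop k) (by simp) ?_ ?_ h2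
    · rw [← List.length_pos_iff]; simp; omega
    · rw [← List.length_pos_iff]; simp; omega
  rw [push, dif_pos ⟨_, ha⟩, hi]
  simp

theorem NoSub.of_append {a b : List ℕ} (h : NoSub (a ++ b)) : NoSub a := by
  rintro x y z rfl
  exact h x y (z ++ b) (by simp)

theorem red_of_noSub {w : List ℕ} (h : NoSub w) : red w = w := by
  induction w using List.reverseRecOn with
  | nil => rfl
  | append_singleton w n ih =>
    rw [red_concat, ih h.of_append]
    refine push_of_forall _ _ fun i hi => ?_
    refine h (w.take i) _ [] ?_ ?_
    · rw [List.append_nil, ← List.append_assoc, List.take_append_drop]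
    · simp; omega

/-- A proper suffix containing `x^(p+q)` misses a leading zero and has weight at least `0`; one
without it consists of `l > 1` zeros and has weight `-l`. -/
theorem wt_suffix_bw {p q : ℕ} {c d : List ℕ} (h : bw p q = c ++ d) (hc : c ≠ [])
    (hd : 1 < d.length) : wt d ≠ -1 := by
  rw [bw] at h
  have hc' : 0 < c.length := List.length_pos_iff.2 hc
  rcases List.append_eq_append_iff.1 h with ⟨e, rfl, he⟩ | ⟨e, he, rfl⟩
  · rcases e with _ | ⟨x, e⟩
    · simp only [List.nil_append] at he
      subst he
      simp only [List.append_nil, List.length_replicate] at hc'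
      simp only [wt, wt_replicate_zero]
      push_cast
      omega
    · simp only [List.cons_append, List.cons.injEq] at he
      obtain ⟨k, l, -, -, rfl⟩ : ∃ k l, q = k + l ∧ e = List.replicate k 0 ∧
          d = List.replicate l 0 := by
        have := List.append_eq_replicate_iff.1 he.2.symm
        exact ⟨_, _, this.1.symm, this.2.1, this.2.2⟩
      rw [wt_replicate_zero]
      simp only [List.length_replicate] at hd
      omega
  · obtain ⟨h1, h2, h3⟩ := List.append_eq_replicate_iff.1 he.symm
    rw [h3, wt_append, wt_replicate_zero, wt, wt_replicate_zero]
    push_cast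
    omega

theorem dropLast_bw_succ (p q : ℕ) :
    (bw p (q + 1)).dropLast = List.replicate p 0 ++ (p + q + 1) :: List.replicate q 0 := by
  have : bw p (q + 1) = (List.replicate p 0 ++ (p + q + 1) :: List.replicate q 0) ++ [0] := by
    simp [bw, List.replicate_succ', add_assoc]
  rw [this, List.dropLast_concat]

theorem dropLast_bw_zero (p : ℕ) : (bw p 0).dropLast = List.replicate p 0 := by
  simp [bw]

/-- Nothing is contracted before the last letter of `v`, and that letter contracts exactly `v` to
`0`. -/
theorem red_append_bw {u₁ : List ℕ} {p q : ℕ} (h : NoSub (u₁ ++ (bw p q).dropLast))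
    (hpq : 0 < p + q) : red (u₁ ++ bw p q) = red (u₁ ++ [0]) := by
  have hb0 : bw p q ≠ [] := by simp [bw]
  have hlen : (bw p q).dropLast.length = p + q := by simp [length_bw]
  have hcat := List.dropLast_append_getLast hb0
  rw [← hcat, ← List.append_assoc, red_concat, red_concat, red_of_noSub h,
    red_of_noSub h.of_append]
  refine push_of_suffix _ _ _ ?_ ?_ ?_
  · rw [← List.length_pos_iff]; omega
  · rw [hcat, wt_bw]
  · intro c d hcd hc hd
    refine wt_suffix_bw (p := p) (q := q) (c := c) ?_ hc ?_
    · rw [← List.append_assoc, ← hcd, hcat]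
    · have := List.length_pos_iff.2 hd
      simp; omega

/-- To the right of `v`, the order of letters is therefore the same before and after the
contraction. -/
theorem topZeros_append_bw {u₁ : List ℕ} {p q : ℕ} (h : NoSub (u₁ ++ (bw p q).dropLast))
    (hpq : 0 < p + q) (s : List ℕ) : topZeros (u₁ ++ bw p q ++ s) = topZeros (u₁ ++ 0 :: s) := by
  rw [topZeros, topZeros, red_append_congr (red_append_bw h hpq)]
  simp

theorem trail_append_zeros (w : List ℕ) (i : ℕ) :
    trail (w ++ List.replicate i 0) = trail w + i := by
  simp [trail]
  omega

/-- No contraction occurs here, so the leading zeros of `v` simply pile up on the stack. -/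
theorem topZeros_append_zeros {u₁ : List ℕ} {p q : ℕ} (h : NoSub (u₁ ++ (bw p q).dropLast))
    (i : ℕ) (hi : i ≤ p) : topZeros (u₁ ++ List.replicate i 0) = topZeros u₁ + i := by
  obtain ⟨s, hs⟩ : ∃ s, (bw p q).dropLast = List.replicate i 0 ++ s := by
    obtain ⟨k, rfl⟩ := Nat.exists_eq_add_of_le hi
    rcases q with _ | q
    · exact ⟨List.replicate k 0, by rw [dropLast_bw_zero, List.replicate_add]⟩
    · refine ⟨List.replicate k 0 ++ (i + k + q + 1) :: List.replicate q 0, ?_⟩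
      rw [dropLast_bw_succ, List.replicate_add, List.append_assoc]
  rw [hs, ← List.append_assoc] at h
  rw [topZeros, topZeros, red_of_noSub h.of_append, red_of_noSub h.of_append.of_append,
    trail_append_zeros]

/-- A zero at the end of `u₁`, followed by `v` without its last letter (a zero, since `q > 0`),
would form a subword of weight `-1`. -/
theorem topZeros_eq_zero {u₁ : List ℕ} {p q : ℕ} (h : NoSub (u₁ ++ (bw p q).dropLast))
    (hq : 0 < q) : topZeros u₁ = 0 := by
  rw [topZeros, red_of_noSub h.of_append]
  obtain ⟨q, rfl⟩ := Nat.exists_eq_add_of_le' hq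
  rw [Nat.succ_eq_add_one, zero_add, dropLast_bw_succ] at h
  rcases List.eq_nil_or_concat u₁ with rfl | ⟨u, n, rfl⟩
  · rfl
  · rcases Nat.eq_zero_or_pos n with rfl | hn
    · refine absurd ?_ (h u (0 :: (List.replicate p 0 ++ (p + q + 1) :: List.replicate q 0)) []
        (by simp) (by simp))
      simp only [wt, wt_append, wt_replicate_zero]
      push_cast
      ring
    · simp [trail, hn.ne']

/-! ### The prefix-dependent order on words -/

/-- The order of the letters that may follow a word with `g = topZeros`: it is
`0 > 1 > ⋯ > g` below `g + 1 < g + 2 < ⋯`. -/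
def rank (g n : ℕ) : ℕ := if g < n then n else g - n

/-- The ranks of the letters of `u` when `u` is read after `c`. -/
def code (c : List ℕ) : List ℕ → List ℕ
  | [] => []
  | n :: u => rank (topZeros c) n :: code (c ++ [n]) u

/-- At the first place where `w` and `u` differ, the letter of `w` is the smaller one. -/
def Less (w u : List ℕ) : Prop := ∃ c a b s s', u = c ++ a :: s ∧ w = c ++ b :: s' ∧
  (b < a ∧ topZeros c < a ∨ a < b ∧ b ≤ topZeros c)

theorem code_append_cons_lt (d c s s' : List ℕ) (a b : ℕ)
    (h : rank (topZeros (d ++ c)) b < rank (topZeros (d ++ c)) a) :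
    code d (c ++ b :: s') < code d (c ++ a :: s) := by
  induction c generalizing d with
  | nil =>
    simp only [List.nil_append, code, List.append_nil] at h ⊢
    exact List.Lex.rel h
  | cons n c ih =>
    simp only [List.cons_append, code]
    exact List.Lex.cons (ih _ (by simpa using h))

/-- Embeds the comparison at the first difference into a linear order, as the leading term argument
requires. -/
theorem Less.code_lt {w u : List ℕ} (h : Less w u) : code [] w < code [] u := by
  obtain ⟨c, a, b, s, s', rfl, rfl, h⟩ := h
  refine code_append_cons_lt _ _ _ _ _ _ ?_
  simp only [List.nil_append, rank]
  rcases h with ⟨h1, h2⟩ | ⟨h1, h2⟩ <;> split_ifs <;> omega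

/-- Localizes the comparison to one factor: what follows the first difference is irrelevant. -/
theorem Less.of_append {c z v : List ℕ} (s s' : List ℕ) (h : ∃ e a b t t', v = e ++ a :: t ∧
    z = e ++ b :: t' ∧ (b < a ∧ topZeros (c ++ e) < a ∨ a < b ∧ b ≤ topZeros (c ++ e))) :
    Less (c ++ z ++ s') (c ++ v ++ s) := by
  obtain ⟨e, a, b, t, t', rfl, rfl, h⟩ := h
  exact ⟨c ++ e, a, b, t ++ s, t' ++ s', by simp, by simp, h⟩

end DiffWord

/-! ### Leaves of grafted trees and of bracketings -/

namespace OpTree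

theorem numLeaves_graft {X : Type u} (t : OpTree X) (i : ℕ) (s : OpTree X)
    (hi : i < t.numLeaves) : (t.graft i s).numLeaves + 1 = t.numLeaves + s.numLeaves := by
  induction t generalizing i with
  | leaf x =>
    obtain rfl : i = 0 := by simpa [numLeaves] using hi
    simp [graft, numLeaves, add_comm]
  | prec l r hl hr =>
    simp only [numLeaves] at hi
    by_cases h : i < l.numLeaves
    · have := hl i h
      simp only [graft, if_pos h, numLeaves]; omega
    · have := hr (i - l.numLeaves) (by omega)
      simp only [graft, if_neg h, numLeaves]; omega
  | succ l r hl hr =>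
    simp only [numLeaves] at hi
    by_cases h : i < l.numLeaves
    · have := hl i h
      simp only [graft, if_pos h, numLeaves]; omega
    · have := hr (i - l.numLeaves) (by omega)
      simp only [graft, if_neg h, numLeaves]; omega

end OpTree

namespace DiffWord

theorem baseTree_prec (p q : ℕ) :
    baseTree (p + 1 + q) (p + 1) = .prec (.leaf ()) (baseTree (p + q) p) := by
  simp only [baseTree, Nat.add_sub_cancel_left, Function.iterate_succ_apply']

theorem baseTree_succ (q : ℕ) : baseTree (q + 1) 0 = .succ (baseTree q 0) (.leaf ()) := by
  simp only [baseTree, Nat.sub_zero, Function.iterate_zero, id_eq, Function.iterate_succ_apply']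

theorem baseTree_zero : baseTree 0 0 = .leaf () := rfl

theorem numLeaves_baseTree (p q : ℕ) : (baseTree (p + q) p).numLeaves = p + q + 1 := by
  induction p with
  | zero =>
    rw [zero_add]
    induction q with
    | zero => rfl
    | succ q ih => simp only [baseTree_succ, OpTree.numLeaves, ih]
  | succ p ih => simp only [baseTree_prec, OpTree.numLeaves, ih]; omega

theorem wt_contract {u₁ u₂ : List ℕ} {p q : ℕ} (h : wt (u₁ ++ bw p q ++ u₂) = -1) :
    wt (u₁ ++ 0 :: u₂) = -1 := by
  simp only [wt_append, wt_bw, wt] at h ⊢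
  push_cast
  omega

theorem numLeaves_bracket (u : List ℕ) (hu : wt u = -1) : (bracket u).numLeaves = u.length := by
  induction hn : u.length using Nat.strong_induction_on generalizing u with
  | _ n ih =>
    rcases bracket_cases u hu with ⟨p, q, rfl⟩ | ⟨u₁, p, q, u₂, rfl, hpq, hb, -⟩
    · rw [bracket_bw, numLeaves_baseTree, ← hn, length_bw]
    · simp only [List.length_append, length_bw] at hn
      have h1 := ih _ (by simp; omega) (u₁ ++ 0 :: u₂) (wt_contract hu) rfl
      have h2 := OpTree.numLeaves_graft (bracket (u₁ ++ 0 :: u₂)) u₁.length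
        (baseTree (p + q) p) (by rw [h1]; simp)
      rw [← hb, h1, numLeaves_baseTree] at h2
      simp only [List.length_append, List.length_cons] at h2
      omega

/-! ### Differentiation of words -/

/-- All words obtained from a word by differentiating one letter. -/
def incs : List ℕ → List (List ℕ)
  | [] => []
  | n :: w => ((n + 1) :: w) :: (incs w).map (n :: ·)

theorem mem_incs_cons {n : ℕ} {w z : List ℕ} :
    z ∈ incs (n :: w) ↔ z = (n + 1) :: w ∨ ∃ w' ∈ incs w, z = n :: w' := by
  simp [incs, eq_comm]

theorem length_of_mem_incs {z z' : List ℕ} (h : z' ∈ incs z) : z'.length = z.length := by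
  induction z generalizing z' with
  | nil => simp [incs] at h
  | cons n w ih =>
    rcases mem_incs_cons.1 h with rfl | ⟨w', hw, rfl⟩
    · rfl
    · simp [ih hw]

theorem sum_of_mem_incs {z z' : List ℕ} (h : z' ∈ incs z) : z'.sum = z.sum + 1 := by
  induction z generalizing z' with
  | nil => simp [incs] at h
  | cons n w ih =>
    rcases mem_incs_cons.1 h with rfl | ⟨w', hw, rfl⟩
    · simp; omega
    · simp [ih hw]; omega

theorem nodup_incs (z : List ℕ) : (incs z).Nodup := by
  induction z with
  | nil => simp [incs]
  | cons n w ih =>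
    rw [incs, List.nodup_cons]
    exact ⟨by simp, ih.map fun a b h => by simpa using h⟩

theorem mem_incs_append_cons (c s : List ℕ) (m : ℕ) : c ++ (m + 1) :: s ∈ incs (c ++ m :: s) := by
  induction c with
  | nil => simp [incs]
  | cons n c ih => exact mem_incs_cons.2 (.inr ⟨_, ih, rfl⟩)

/-- Undoing a differentiation lowers a positive letter, and `m + 1` is the only one. Hence no other
word contributes to the leading word after differentiating. -/
theorem eq_of_mem_incs {p q m : ℕ} {z : List ℕ}
    (h : List.replicate p 0 ++ (m + 1) :: List.replicate q 0 ∈ incs z) :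
    z = List.replicate p 0 ++ m :: List.replicate q 0 := by
  induction p generalizing z with
  | zero =>
    rcases z with _ | ⟨n, w⟩
    · simp [incs] at h
    rcases mem_incs_cons.1 h with h | ⟨w', hw, h⟩
    · simp_all
    · have := sum_of_mem_incs hw
      simp only [List.replicate_zero, List.nil_append, List.cons.injEq] at h
      simp [← h.2] at this
  | succ p ih =>
    rcases z with _ | ⟨n, w⟩
    · simp [incs] at h
    rcases mem_incs_cons.1 h with h | ⟨w', hw, h⟩
    · simp [List.replicate_succ] at h
    · simp only [List.replicate_succ, List.cons_append, List.cons.injEq] at h ⊢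
      rw [← h.2] at hw
      exact ⟨h.1.symm, ih hw⟩

/-- If the first nonzero letter of `z` is preceded by `i < p` zeros, then it is at most
`j + i`. -/
def Bounded (p j : ℕ) (z : List ℕ) : Prop :=
  ∀ i < p, ∀ r s, z = List.replicate i 0 ++ r :: s → r ≤ j + i

theorem Bounded.of_mem_incs {p j : ℕ} {z z' : List ℕ} (h : Bounded p j z) (hz : z' ∈ incs z) :
    Bounded p (j + 1) z' := by
  induction z generalizing z' p j with
  | nil => simp [incs] at hz
  | cons n w ih =>
    intro i hi r s hs
    have hn : n ≤ j := h 0 (by omega) n w rfl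
    rcases mem_incs_cons.1 hz with rfl | ⟨w', hw, rfl⟩
    · rcases i with _ | i
      · simp at hs; omega
      · simp [List.replicate_succ] at hs
    · rcases i with _ | i
      · simp at hs; omega
      · simp only [List.replicate_succ, List.cons_append, List.cons.injEq] at hs
        obtain ⟨rfl, rfl⟩ := hs
        have hb : Bounded (p - 1) (j + 1) w := by
          rintro i' hi' r' s' rfl
          have := h (i' + 1) (by omega) r' s' (by simp [List.replicate_succ])
          omega
        have := ih hb hw i (by omega) r s rfl
        omega

/-- A new leading zero compensates for one differentiation, so `y ↦ x d(y)` preserves the bound `j`.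
-/
theorem Bounded.zero_cons {p j : ℕ} {z : List ℕ} (h : Bounded p (j + 1) z) :
    Bounded (p + 1) j (0 :: z) := by
  intro i hi r s hs
  rcases i with _ | i
  · simp at hs; omega
  · simp only [List.replicate_succ, List.cons_append, List.cons.injEq, true_and] at hs
    have := h i (by omega) r s hs
    omega

/-- Let `i` be the number of leading zeros of `z`. If `i < p`, the next letter of `z` is at most
`i`, in the range of the reversed order, where it is below `0`. If `i ≥ p` and `q > 0`, the letter
of `z` after `p` zeros is less than `p + q`, which exceeds `topZeros = p`. If `q = 0`, only `z = bw
p 0` remains. -/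
theorem exists_less_of_ne_bw {u₁ z : List ℕ} {p q : ℕ}
    (h1 : ∀ i ≤ p, topZeros (u₁ ++ List.replicate i 0) = topZeros u₁ + i)
    (h2 : 0 < q → topZeros u₁ = 0) (hl : z.length = p + q + 1) (hs : z.sum = p + q)
    (hb : Bounded p 0 z) (hz : z ≠ bw p q) : ∃ e a b t t', bw p q = e ++ a :: t ∧
      z = e ++ b :: t' ∧ (b < a ∧ topZeros (u₁ ++ e) < a ∨ a < b ∧ b ≤ topZeros (u₁ ++ e)) := by
  have key : ∀ r s, z = List.replicate p 0 ++ r :: s → r < p + q → 0 < q →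
      ∃ e a b t t', bw p q = e ++ a :: t ∧ z = e ++ b :: t' ∧
        (b < a ∧ topZeros (u₁ ++ e) < a ∨ a < b ∧ b ≤ topZeros (u₁ ++ e)) := by
    intro r s hz hr hq
    refine ⟨List.replicate p 0, p + q, r, List.replicate q 0, s, rfl, hz, .inl ⟨hr, ?_⟩⟩
    rw [h1 p le_rfl, h2 hq]
    omega
  rcases eq_replicate_or_cons z with ⟨n, rfl⟩ | ⟨i, r, s, hr, rfl⟩
  · simp only [List.length_replicate, List.sum_replicate, smul_zero] at hl hs
    obtain ⟨rfl, rfl⟩ : p = 0 ∧ q = 0 := by omega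
    subst hl
    exact absurd rfl hz
  · simp only [List.length_append, List.length_replicate, List.length_cons] at hl
    simp only [List.sum_append, List.sum_replicate, smul_zero, zero_add, List.sum_cons] at hs
    rcases lt_trichotomy i p with hi | rfl | hi
    · have := hb i hi r s rfl
      obtain ⟨k, rfl⟩ := Nat.exists_eq_add_of_lt hi
      refine ⟨List.replicate i 0, 0, r,
        List.replicate k 0 ++ (i + k + 1 + q) :: List.replicate q 0, s, ?_, rfl, .inr ⟨hr, ?_⟩⟩
      · rw [bw, show i + k + 1 = i + (k + 1) from rfl, List.replicate_add, List.replicate_succ]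
        simp
      · rw [h1 i (by omega)]
        omega
    · rcases Nat.eq_zero_or_pos q with rfl | hq
      · obtain rfl : s = [] := List.length_eq_zero_iff.1 (by omega)
        simp only [List.sum_nil, add_zero] at hs
        subst hs
        exact absurd (by simp [bw]) hz
      · refine key r s rfl ?_ hq
        by_contra hcon
        have hs0 : s.sum = 0 := by omega
        refine hz ?_
        rw [bw, show r = i + q by omega]
        congr 2
        refine List.eq_replicate_iff.2 ⟨by omega, fun x hx => ?_⟩
        exact List.sum_eq_zero_iff.1 hs0 x hx
    · obtain ⟨k, rfl⟩ := Nat.exists_eq_add_of_lt hi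
      refine key 0 (List.replicate k 0 ++ r :: s) ?_ (by omega) (by omega)
      rw [show p + k + 1 = p + (k + 1) from rfl, List.replicate_add, List.replicate_succ]
      simp

/-- Handles the `j`-th derivative of a base tree with `q = 0`. The bound `j + i ≤ topZeros u₁ + i`
keeps the first nonzero letter in the range of the reversed order, where raising a letter makes the
word smaller. -/
theorem exists_less_of_bounded {u₁ z : List ℕ} {p j : ℕ}
    (h1 : ∀ i ≤ p, topZeros (u₁ ++ List.replicate i 0) = topZeros u₁ + i)
    (hj : 0 < j) (hj' : j ≤ topZeros u₁) (hl : z.length = p + 1) (hs : z.sum = p + j)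
    (hb : Bounded (p + 1) j z) : ∃ e a b t t', bw p 0 = e ++ a :: t ∧
      z = e ++ b :: t' ∧ (b < a ∧ topZeros (u₁ ++ e) < a ∨ a < b ∧ b ≤ topZeros (u₁ ++ e)) := by
  rcases eq_replicate_or_cons z with ⟨n, rfl⟩ | ⟨i, r, s, hr, rfl⟩
  · simp only [List.sum_replicate, smul_zero] at hs
    omega
  · simp only [List.length_append, List.length_replicate, List.length_cons] at hl
    have hr' := hb i (by omega) r s rfl
    simp only [List.sum_append, List.sum_replicate, smul_zero, zero_add, List.sum_cons] at hs
    rcases (show i ≤ p by omega).lt_or_eq with hi | rfl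
    · obtain ⟨k, rfl⟩ := Nat.exists_eq_add_of_lt hi
      refine ⟨List.replicate i 0, 0, r, List.replicate k 0 ++ [i + k + 1], s, ?_, rfl,
        .inr ⟨hr, ?_⟩⟩
      · rw [bw, show i + k + 1 = i + (k + 1) from rfl, List.replicate_add, List.replicate_succ]
        simp
      · rw [h1 i (by omega)]
        omega
    · obtain rfl : s = [] := List.length_eq_zero_iff.1 (by omega)
      simp only [List.sum_nil, add_zero] at hs
      refine ⟨List.replicate i 0, i, r, [], [], by simp [bw], rfl, .inr ⟨by omega, ?_⟩⟩
      rw [h1 i le_rfl]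
      omega

theorem topZeros_replicate (i : ℕ) : topZeros (List.replicate i 0) = i := by
  have h : NoSub (List.replicate i 0) := by
    intro a b c habc hb hwt
    obtain ⟨-, h, -⟩ := List.append_eq_replicate_iff.1 habc.symm
    obtain ⟨-, -, h⟩ := List.append_eq_replicate_iff.1 h
    rw [h, wt_replicate_zero] at hwt
    omega
  rw [topZeros, red_of_noSub h]
  simp [trail]

/-! ### Values of trees in a differential algebra -/

section Triangular

variable {𝕜 : Type u} {D : Type v} [CommRing 𝕜] [Ring D] [Algebra 𝕜 D] (d : D →ₗ[𝕜] D)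

/-- The value of a tree whose leaves are labelled by the elements of the list `a` when
`x ≺ y = x d(y)` and `x ≻ y = d(x) y`. -/
def diffEval : OpTree Unit → List D → D
  | .leaf _, a => a.headD 0
  | .prec l r, a => diffEval l (a.take l.numLeaves) * d (diffEval r (a.drop l.numLeaves))
  | .succ l r, a => d (diffEval l (a.take l.numLeaves)) * diffEval r (a.drop l.numLeaves)

/-- The product of the derivatives of the elements of `a` of orders given by `w`. -/
def diffMon (w : List ℕ) (a : List D) : D := (List.zipWith (fun n x => (d ^ n) x) w a).prod

theorem diffMon_nil (a : List D) : diffMon d [] a = 1 := by simp [diffMon]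

theorem diffMon_cons (n : ℕ) (w : List ℕ) (x : D) (a : List D) :
    diffMon d (n :: w) (x :: a) = (d ^ n) x * diffMon d w a := by simp [diffMon]

theorem diffMon_append {w : List ℕ} {a : List D} (h : w.length = a.length) (w' : List ℕ)
    (a' : List D) : diffMon d (w ++ w') (a ++ a') = diffMon d w a * diffMon d w' a' := by
  rw [diffMon, List.zipWith_append h, List.prod_append, diffMon, diffMon]

/-- The span of the monomials given by the words that satisfy `P`. -/
def monSpan (P : List ℕ → Prop) (a : List D) : Submodule 𝕜 D :=
  Submodule.span 𝕜 {y | ∃ z : List ℕ, z.length = a.length ∧ P z ∧ y = diffMon d z a}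

variable {d}

theorem diffMon_mem_monSpan {P : List ℕ → Prop} {a : List D} {z : List ℕ}
    (hl : z.length = a.length) (hz : P z) : diffMon d z a ∈ monSpan d P a :=
  Submodule.subset_span ⟨z, hl, hz, rfl⟩

theorem monSpan_induction {P : List ℕ → Prop} {a : List D} (N : Submodule 𝕜 D) (f : D →ₗ[𝕜] D)
    (h : ∀ z : List ℕ, z.length = a.length → P z → f (diffMon d z a) ∈ N) {y : D}
    (hy : y ∈ monSpan d P a) : f y ∈ N := by
  have : monSpan d P a ≤ N.comap f := by
    refine Submodule.span_le.2 ?_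
    rintro _ ⟨z, hl, hz, rfl⟩
    exact h z hl hz
  exact this hy

theorem monSpan_mono {P Q : List ℕ → Prop} {a : List D}
    (h : ∀ z : List ℕ, z.length = a.length → P z → Q z) : monSpan d P a ≤ monSpan d Q a := by
  refine Submodule.span_mono ?_
  rintro _ ⟨z, hl, hz, rfl⟩
  exact ⟨z, hl, h z hl hz, rfl⟩

theorem mul_mul_mem_monSpan {P Q : List ℕ → Prop} {w₁ w₂ : List ℕ} {a₁ a a₂ : List D}
    (h₁ : w₁.length = a₁.length) (h₂ : w₂.length = a₂.length)
    (h : ∀ z : List ℕ, z.length = a.length → P z → Q (w₁ ++ z ++ w₂)) {y : D}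
    (hy : y ∈ monSpan d P a) :
    diffMon d w₁ a₁ * y * diffMon d w₂ a₂ ∈ monSpan d Q (a₁ ++ a ++ a₂) := by
  refine monSpan_induction _ (LinearMap.mulRight 𝕜 (diffMon d w₂ a₂) ∘ₗ
    LinearMap.mulLeft 𝕜 (diffMon d w₁ a₁)) (fun z hl hz => ?_) hy
  simp only [LinearMap.comp_apply, LinearMap.mulLeft_apply, LinearMap.mulRight_apply]
  rw [← diffMon_append d h₁, ← diffMon_append d (by simp [h₁, hl])]
  exact diffMon_mem_monSpan (by simp [h₁, h₂, hl]) (h z hl hz)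

theorem diffEval_graft (t s : OpTree Unit) (a₁ a a₂ : List D) (ha : a.length = s.numLeaves)
    (h : a₁.length + 1 + a₂.length = t.numLeaves) :
    diffEval d (t.graft a₁.length s) (a₁ ++ a ++ a₂) =
      diffEval d t (a₁ ++ [diffEval d s a] ++ a₂) := by
  -- `left` and `right` split the labels at the boundary between the two subtrees, according to the
  -- side of the grafted leaf.
  have left : ∀ n : ℕ, a₁.length < n → n ≤ a₁.length + 1 + a₂.length →
      ∃ b c, a₂ = b ++ c ∧ a₁.length + 1 + b.length = n := fun n h1 h2 =>
    ⟨a₂.take (n - 1 - a₁.length), a₂.drop (n - 1 - a₁.length), by simp, by simp; omega⟩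
  have right : ∀ n : ℕ, n ≤ a₁.length → ∃ b c, a₁ = b ++ c ∧ b.length = n := fun n h1 =>
    ⟨a₁.take n, a₁.drop n, by simp, by simp; omega⟩
  induction t generalizing a₁ a₂ with
  | leaf x =>
    simp only [OpTree.numLeaves] at h
    obtain rfl : a₁ = [] := List.length_eq_zero_iff.1 (by omega)
    obtain rfl : a₂ = [] := List.length_eq_zero_iff.1 (by simpa using h)
    simp [OpTree.graft, diffEval]
  | prec l r hl hr =>
    simp only [OpTree.numLeaves] at h
    by_cases hi : a₁.length < l.numLeaves
    · obtain ⟨b, c, rfl, hb⟩ := left l.numLeaves hi (by omega)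
      have hn : (l.graft a₁.length s).numLeaves = (a₁ ++ a ++ b).length := by
        have := OpTree.numLeaves_graft l a₁.length s hi
        simp only [List.length_append]
        omega
      rw [OpTree.graft, if_pos hi, diffEval, diffEval, hn, ← List.append_assoc,
        ← List.append_assoc, List.take_left, List.drop_left,
        List.take_left' (by simp; omega), List.drop_left' (by simp; omega), hl a₁ b hb]
      · exact fun n h1 h2 => ⟨b.take (n - 1 - a₁.length), b.drop (n - 1 - a₁.length), by simp,
          by simp; omega⟩
      · exact right
    · obtain ⟨b, c, rfl, hb⟩ := right l.numLeaves (by omega)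
      simp only [List.length_append] at h
      rw [OpTree.graft, if_neg hi, diffEval, diffEval, List.length_append, hb,
        Nat.add_sub_cancel_left, List.append_assoc, List.append_assoc, List.append_assoc,
        List.append_assoc, List.take_left' hb, List.drop_left' hb, List.take_left' hb,
        List.drop_left' hb, ← List.append_assoc, ← List.append_assoc, hr c a₂ (by omega)]
      · exact fun n h1 h2 => ⟨a₂.take (n - 1 - c.length), a₂.drop (n - 1 - c.length), by simp,
          by simp; omega⟩
      · exact fun n h1 => ⟨c.take n, c.drop n, by simp, by simp; omega⟩
  | succ l r hl hr =>
    simp only [OpTree.numLeaves] at h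
    by_cases hi : a₁.length < l.numLeaves
    · obtain ⟨b, c, rfl, hb⟩ := left l.numLeaves hi (by omega)
      have hn : (l.graft a₁.length s).numLeaves = (a₁ ++ a ++ b).length := by
        have := OpTree.numLeaves_graft l a₁.length s hi
        simp only [List.length_append]
        omega
      rw [OpTree.graft, if_pos hi, diffEval, diffEval, hn, ← List.append_assoc,
        ← List.append_assoc, List.take_left, List.drop_left,
        List.take_left' (by simp; omega), List.drop_left' (by simp; omega), hl a₁ b hb]
      · exact fun n h1 h2 => ⟨b.take (n - 1 - a₁.length), b.drop (n - 1 - a₁.length), by simp,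
          by simp; omega⟩
      · exact right
    · obtain ⟨b, c, rfl, hb⟩ := right l.numLeaves (by omega)
      simp only [List.length_append] at h
      rw [OpTree.graft, if_neg hi, diffEval, diffEval, List.length_append, hb,
        Nat.add_sub_cancel_left, List.append_assoc, List.append_assoc, List.append_assoc,
        List.append_assoc, List.take_left' hb, List.drop_left' hb, List.take_left' hb,
        List.drop_left' hb, ← List.append_assoc, ← List.append_assoc, hr c a₂ (by omega)]
      · exact fun n h1 h2 => ⟨a₂.take (n - 1 - c.length), a₂.drop (n - 1 - c.length), by simp,
          by simp; omega⟩
      · exact fun n h1 => ⟨c.take n, c.drop n, by simp, by simp; omega⟩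
theorem map_one_eq_zero_of_leibniz
    (hd : ∀ x y : D, d (x * y) = d x * y + x * d y) :
    d 1 = 0 := by
  have := hd 1 1
  simpa using this

theorem map_diffMon
    (hd : ∀ x y : D, d (x * y) = d x * y + x * d y)
    {z : List ℕ} {a : List D} (h : z.length = a.length) :
    d (diffMon d z a) = ((incs z).map (diffMon d · a)).sum := by
  induction z generalizing a with
  | nil => simp [incs, diffMon, map_one_eq_zero_of_leibniz hd]
  | cons n w ih =>
    rcases a with _ | ⟨x, a⟩
    · simp at h
    · rw [diffMon_cons, hd, ih (by simpa using h), incs, List.map_cons, List.sum_cons,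
        diffMon_cons, pow_succ', Module.End.mul_apply, List.map_map, ← List.sum_map_mul_left]
      simp [Function.comp_def, diffMon_cons]

theorem map_mem_monSpan
    (hd : ∀ x y : D, d (x * y) = d x * y + x * d y)
    {P Q : List ℕ → Prop} {a : List D}
    (h : ∀ z z', P z → z' ∈ incs z → Q z') {y : D} (hy : y ∈ monSpan d P a) :
    d y ∈ monSpan d Q a := by
  refine monSpan_induction _ d (fun z hl hz => ?_) hy
  rw [map_diffMon hd hl]
  refine list_sum_mem ?_
  simp only [List.mem_map]
  rintro _ ⟨z', hz', rfl⟩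
  exact diffMon_mem_monSpan ((length_of_mem_incs hz').trans hl) (h z z' hz hz')

theorem pow_map_mem_monSpan
    (hd : ∀ x y : D, d (x * y) = d x * y + x * d y)
    {P : ℕ → List ℕ → Prop} {a : List D}
    (h : ∀ j z z', P j z → z' ∈ incs z → P (j + 1) z') {y : D} (hy : y ∈ monSpan d (P 0) a)
    (j : ℕ) : (d ^ j) y ∈ monSpan d (P j) a := by
  induction j with
  | zero => simpa using hy
  | succ j ih =>
    rw [pow_succ', Module.End.mul_apply]
    exact map_mem_monSpan hd (h j) ih

/-- The Leibniz rule produces each word only once (`nodup_incs`), so subtracting the chosen term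
removes that word altogether. -/
theorem map_diffMon_sub_mem
    (hd : ∀ x y : D, d (x * y) = d x * y + x * d y)
    {c s : List ℕ} {m : ℕ} {a : List D}
    (h : (c ++ m :: s).length = a.length) :
    d (diffMon d (c ++ m :: s) a) - diffMon d (c ++ (m + 1) :: s) a ∈
      monSpan d (fun z => z ∈ incs (c ++ m :: s) ∧ z ≠ c ++ (m + 1) :: s) a := by
  obtain ⟨l₁, l₂, hl⟩ := List.append_of_mem (mem_incs_append_cons c s m)
  have hn := nodup_incs (c ++ m :: s)
  rw [hl, List.nodup_middle, List.nodup_cons] at hn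
  rw [map_diffMon hd h, hl]
  simp only [List.map_append, List.map_cons, List.sum_append, List.sum_cons]
  rw [show ∀ x y z : D, x + (y + z) - y = x + z from fun x y z => by abel, ← List.sum_append,
    ← List.map_append]
  refine list_sum_mem ?_
  simp only [List.mem_map]
  rintro _ ⟨z, hz, rfl⟩
  have hz' : z ∈ incs (c ++ m :: s) := by
    rw [hl]
    simp only [List.mem_append, List.mem_cons] at hz ⊢
    tauto
  refine diffMon_mem_monSpan ((length_of_mem_incs hz').trans h) ⟨by rwa [hl] at hz', ?_⟩
  rintro rfl
  exact hn.1 hz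

/-- The tree arises from a leaf by `q` steps `y ↦ d(y) x` and then `p` steps `y ↦ x d(y)`. Each step
raises the large letter of the leading word by one, in a single way. During the first steps the
bound is vacuous; during the others the new leading zero restores it. -/
theorem diffEval_baseTree_sub_mem
    (hd : ∀ x y : D, d (x * y) = d x * y + x * d y)
    (p q : ℕ) (a : List D) (ha : a.length = p + q + 1) :
    diffEval d (baseTree (p + q) p) a - diffMon d (bw p q) a ∈
      monSpan d (fun z => z ≠ bw p q ∧ z.sum = p + q ∧ Bounded p 0 z) a := by
  have step : ∀ p q : ℕ, ∀ a : List D, a.length = p + q + 1 → ∀ y,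
      y - diffMon d (bw p q) a ∈ monSpan d (fun z => z ≠ bw p q ∧ z.sum = p + q ∧
        Bounded p 0 z) a →
      d y - diffMon d (List.replicate p 0 ++ (p + q + 1) :: List.replicate q 0) a ∈
        monSpan d (fun z => z ≠ List.replicate p 0 ++ (p + q + 1) :: List.replicate q 0 ∧
          z.sum = p + q + 1 ∧ Bounded p 1 z) a := by
    intro p q a ha y hy
    have h1 := map_mem_monSpan hd (Q := fun z => z ≠ List.replicate p 0 ++ (p + q + 1) ::
      List.replicate q 0 ∧ z.sum = p + q + 1 ∧ Bounded p 1 z) (fun z z' hz hz' => ⟨?_, ?_, ?_⟩) hy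
    · have h2 := map_diffMon_sub_mem hd (c := List.replicate p 0) (m := p + q)
        (s := List.replicate q 0) (a := a) (by rw [ha, ← length_bw, bw])
      have h3 : monSpan d (fun z => z ∈ incs (List.replicate p 0 ++ (p + q) :: List.replicate q 0) ∧
          z ≠ List.replicate p 0 ++ (p + q + 1) :: List.replicate q 0) a ≤
          monSpan d (fun z => z ≠ List.replicate p 0 ++ (p + q + 1) :: List.replicate q 0 ∧
          z.sum = p + q + 1 ∧ Bounded p 1 z) a := by
        refine monSpan_mono fun z hl hz => ⟨hz.2, ?_, ?_⟩
        · rw [sum_of_mem_incs hz.1]; simp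
        · refine Bounded.of_mem_incs (j := 0) ?_ hz.1
          intro i hi r s hs
          obtain ⟨k, rfl⟩ := Nat.exists_eq_add_of_lt hi
          rw [show i + k + 1 = i + (k + 1) from rfl, List.replicate_add, List.replicate_succ,
            List.append_assoc, List.append_cancel_left_eq] at hs
          simp at hs
          omega
      have h4 := add_mem h1 (h3 h2)
      rw [map_sub, bw] at h4
      simpa using h4
    · rintro rfl
      exact hz.1 (eq_of_mem_incs hz')
    · rw [sum_of_mem_incs hz', hz.2.1]
    · exact hz.2.2.of_mem_incs hz'
  induction p generalizing a with
  | zero =>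
    rw [zero_add]
    induction q generalizing a with
    | zero =>
      obtain ⟨x, rfl⟩ := List.length_eq_one_iff.1 ha
      simp [baseTree_zero, diffEval, bw, diffMon]
    | succ q ih =>
      obtain ⟨a, x, rfl⟩ : ∃ a' x, a = a' ++ [x] :=
        ⟨a.dropLast, a.getLast (by rintro rfl; simp at ha),
          (List.dropLast_append_getLast _).symm⟩
      have hl : a.length = 0 + q + 1 := by simpa [add_assoc] using ha
      have h1 := step 0 q a hl _ (by rw [zero_add]; exact ih a hl)
      have hn : (baseTree q 0).numLeaves = a.length := by
        have := numLeaves_baseTree 0 q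
        rw [zero_add] at this
        rw [this, hl]; omega
      rw [baseTree_succ, diffEval, hn, List.take_left, List.drop_left, diffEval, List.headD_cons]
      have h2 := mul_mul_mem_monSpan (w₁ := []) (a₁ := []) (w₂ := [0]) (a₂ := [x]) rfl rfl
        (Q := fun z => z ≠ bw 0 (q + 1) ∧ z.sum = 0 + (q + 1) ∧ Bounded 0 0 z)
        (fun z hz hz' => ⟨?_, ?_, ?_⟩) h1
      · rw [mul_sub, sub_mul, ← diffMon_append d rfl, ← diffMon_append d (by simp [hl])] at h2
        simpa [diffMon_nil, diffMon_cons, bw, List.replicate_succ'] using h2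
      · intro h
        refine hz'.1 ?_
        rw [bw, List.replicate_succ'] at h
        have := List.append_cancel_right (as := z) (bs := [0])
          (cs := List.replicate 0 0 ++ (0 + q + 1) :: List.replicate q 0)
        refine this ?_
        simpa [add_assoc] using h
      · simp [hz'.2.1]
      · intro i hi
        omega
  | succ p ih =>
    rcases a with _ | ⟨x, a⟩
    · simp at ha
    have hl : a.length = p + q + 1 := by simp at ha; omega
    have h1 := step p q a hl _ (ih a hl)
    rw [baseTree_prec, diffEval, OpTree.numLeaves, diffEval, List.take_one, List.drop_one]
    have h2 := mul_mul_mem_monSpan (w₁ := [0]) (a₁ := [x]) (w₂ := []) (a₂ := []) rfl rfl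
      (Q := fun z => z ≠ bw (p + 1) q ∧ z.sum = p + 1 + q ∧ Bounded (p + 1) 0 z)
      (fun z hz hz' => ⟨?_, ?_, ?_⟩) h1
    · rw [mul_sub, sub_mul, ← diffMon_append d rfl, ← diffMon_append d (by simp; omega)] at h2
      have hbw : bw (p + 1) q = 0 :: (List.replicate p 0 ++ (p + q + 1) :: List.replicate q 0) := by
        rw [bw, List.replicate_succ, show p + 1 + q = p + q + 1 by omega]
        rfl
      rw [hbw]
      rw [hbw] at h2
      simpa [diffMon_nil, diffMon_cons] using h2
    · intro h
      refine hz'.1 ?_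
      rw [bw, List.replicate_succ, show p + 1 + q = p + q + 1 by omega] at h
      simpa using h
    · simp [hz'.2.1]; omega
    · simpa using hz'.2.2.zero_cons

/-- Needed when a smaller word differentiates the contracted letter `j` times. For `q = 0` the bound
also covers words whose only nonzero letter is the last one, hence `p + 1`. -/
theorem pow_diffEval_baseTree_mem
    (hd : ∀ x y : D, d (x * y) = d x * y + x * d y)
    (p j : ℕ) (a : List D) (ha : a.length = p + 1) :
    (d ^ j) (diffEval d (baseTree p p) a) ∈
      monSpan d (fun z => z.sum = p + j ∧ Bounded (p + 1) j z) a := by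
  refine pow_map_mem_monSpan hd (P := fun j z => z.sum = p + j ∧ Bounded (p + 1) j z)
    (fun j z z' hz hz' => ⟨?_, hz.2.of_mem_incs hz'⟩) ?_ j
  · rw [sum_of_mem_incs hz', hz.1, add_assoc]
  · induction p generalizing a with
    | zero =>
      obtain ⟨x, rfl⟩ := List.length_eq_one_iff.1 ha
      have : diffEval d (baseTree 0 0) [x] = diffMon d [0] [x] := by
        simp [baseTree_zero, diffEval, diffMon]
      rw [this]
      refine diffMon_mem_monSpan rfl ⟨rfl, fun i hi r s h => ?_⟩
      obtain rfl : i = 0 := by omega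
      simp at h
      omega
    | succ p ih =>
      rcases a with _ | ⟨x, a⟩
      · simp at ha
      have h1 := map_mem_monSpan hd (Q := fun z => z.sum = p + 1 ∧ Bounded (p + 1) 1 z)
        (fun z z' hz hz' => ⟨by rw [sum_of_mem_incs hz', hz.1, add_zero],
          hz.2.of_mem_incs hz'⟩) (ih a (by simpa using ha))
      have h2 := mul_mul_mem_monSpan (w₁ := [0]) (a₁ := [x]) (w₂ := []) (a₂ := []) rfl rfl
        (Q := fun z => z.sum = p + 1 + 0 ∧ Bounded (p + 1 + 1) 0 z)
        (fun z hz hz' => ⟨by simp [hz'.1], by simpa using hz'.2.zero_cons⟩) h1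
      have hb := baseTree_prec p 0
      rw [add_zero, add_zero] at hb
      rw [hb, diffEval, OpTree.numLeaves, diffEval, List.take_one, List.drop_one]
      simpa [diffMon_nil, diffMon_cons] using h2

end Triangular

/-! ### Triangularity of the standard bracketing -/

/-- The monomials of the value of `[u]` are `u` with coefficient one and smaller ones. -/
theorem diffEval_bracket_sub_mem {𝕜 : Type u} {D : Type v} [CommRing 𝕜] [Ring D] [Algebra 𝕜 D]
    {d : D →ₗ[𝕜] D} (hd : ∀ x y : D, d (x * y) = d x * y + x * d y) (u : List ℕ)
    (hu : wt u = -1) (a : List D) (ha : a.length = u.length) :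
    diffEval d (bracket u) a - diffMon d u a ∈ monSpan d (Less · u) a := by
  induction hn : u.length using Nat.strong_induction_on generalizing u a with
  | _ n ih =>
  rcases bracket_cases u hu with ⟨p, q, rfl⟩ | ⟨u₁, p, q, u₂, rfl, hpq, hb, hN⟩
  · rw [bracket_bw]
    rw [length_bw] at ha
    refine monSpan_mono (fun z hl hz => ?_) (diffEval_baseTree_sub_mem hd p q a ha)
    have := Less.of_append (c := []) [] [] (exists_less_of_ne_bw (u₁ := []) (p := p) (q := q)
      (fun i _ => by simp [topZeros_replicate, show topZeros [] = 0 from rfl]) (fun _ => rfl)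
      (hl.trans ha) hz.2.1 hz.2.2 hz.1)
    simpa using this
  · simp only [List.length_append, length_bw] at hn ha
    obtain ⟨a₁, a', a₂, rfl, h₁, h', h₂⟩ : ∃ a₁ a' a₂, a = a₁ ++ a' ++ a₂ ∧
        a₁.length = u₁.length ∧ a'.length = p + q + 1 ∧ a₂.length = u₂.length := by
      refine ⟨a.take u₁.length, (a.drop u₁.length).take (p + q + 1),
        a.drop (u₁.length + (p + q + 1)), ?_, ?_, ?_, ?_⟩
      · rw [← List.drop_drop, List.append_assoc, List.take_append_drop, List.take_append_drop]
      · simp; omega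
      · simp; omega
      · simp; omega
    have hwt := wt_contract hu
    have hz1 := fun i hi => topZeros_append_zeros hN i hi
    have hz2 := fun hq => topZeros_eq_zero hN hq
    have hbase := diffEval_baseTree_sub_mem hd p q a' h'
    have hlow : ∀ z : List ℕ, z.length = a'.length → (z ≠ bw p q ∧ z.sum = p + q ∧
        Bounded p 0 z) → ∀ s, Less (u₁ ++ z ++ s) (u₁ ++ bw p q ++ u₂) := fun z hl hz s =>
      Less.of_append u₂ s (exists_less_of_ne_bw hz1 hz2 (hl.trans h') hz.2.1 hz.2.2 hz.1)
    have hIH := ih (u₁ ++ 0 :: u₂).length (by simp; omega) (u₁ ++ 0 :: u₂) hwt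
      (a₁ ++ [diffEval d (baseTree (p + q) p) a'] ++ a₂) (by simp [h₁, h₂]) rfl
    rw [hb, ← h₁, diffEval_graft _ _ _ _ _ (by rw [h', numLeaves_baseTree])
      (by rw [numLeaves_bracket _ hwt, h₁, h₂]; simp; omega)]
    set y := diffEval d (baseTree (p + q) p) a' with hy
    have hmon : ∀ w₁ j w₂, w₁.length = u₁.length →
        diffMon d (w₁ ++ j :: w₂) (a₁ ++ [y] ++ a₂) =
          diffMon d w₁ a₁ * (d ^ j) y * diffMon d w₂ a₂ := by
      intro w₁ j w₂ hw
      rw [List.append_assoc, diffMon_append d (hw.trans h₁.symm), List.singleton_append,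
        diffMon_cons, mul_assoc]
    have hmon' : diffMon d (u₁ ++ bw p q ++ u₂) (a₁ ++ a' ++ a₂) =
        diffMon d u₁ a₁ * diffMon d (bw p q) a' * diffMon d u₂ a₂ := by
      rw [diffMon_append d (by simp [h₁, h', length_bw]), diffMon_append d h₁.symm]
    -- The error splits into that of the contracted word, with `y` as a leaf, and the lower terms of
    -- `y` placed between `u₁` and `u₂`.
    have hdecomp : ∀ e : D, e - diffMon d (u₁ ++ bw p q ++ u₂) (a₁ ++ a' ++ a₂) =
        (e - diffMon d (u₁ ++ 0 :: u₂) (a₁ ++ [y] ++ a₂)) +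
          diffMon d u₁ a₁ * (y - diffMon d (bw p q) a') * diffMon d u₂ a₂ := by
      intro e
      rw [hmon u₁ 0 u₂ rfl, hmon', pow_zero, Module.End.one_apply, mul_sub, sub_mul]
      abel
    rw [hdecomp]
    refine add_mem ?_ (mul_mul_mem_monSpan h₁.symm h₂.symm (fun z hl hz => hlow z hl hz u₂) hbase)
    have hsub : monSpan d (Less · (u₁ ++ 0 :: u₂)) (a₁ ++ [y] ++ a₂) ≤
        monSpan d (Less · (u₁ ++ bw p q ++ u₂)) (a₁ ++ a' ++ a₂) := by
      refine Submodule.span_le.2 ?_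
      rintro _ ⟨w, hwl, hw, rfl⟩
      simp only [List.length_append, List.length_singleton, h₁, h₂] at hwl
      obtain ⟨w₁, j, w₂, rfl, hw₁, hw₂⟩ : ∃ w₁ j w₂, w = w₁ ++ j :: w₂ ∧
          w₁.length = u₁.length ∧ w₂.length = u₂.length := by
        refine ⟨w.take u₁.length, w[u₁.length], w.drop (u₁.length + 1), ?_, ?_, ?_⟩
        · simp
        · simp; omega
        · simp; omega
      rw [SetLike.mem_coe, hmon _ _ _ hw₁]
      obtain ⟨c, x, b, s, s', hu', hw', hlt⟩ := hw
      rcases lt_trichotomy c.length u₁.length with hc | hc | hc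
      -- First difference inside `u₁`: it decides, whatever words `(d ^ j) y` contains.
      · obtain ⟨e, rfl, he⟩ : ∃ e, u₁ = c ++ x :: e ∧ e ++ 0 :: u₂ = s := by
          rcases List.append_eq_append_iff.1 hu' with ⟨e, rfl, he⟩ | ⟨e, rfl, he⟩
          · simp at hc
          · rcases e with _ | ⟨x', e⟩
            · simp at hc
            · simp only [List.cons_append, List.cons.injEq] at he
              obtain ⟨rfl, rfl⟩ := he
              exact ⟨e, rfl, rfl⟩
        obtain ⟨e', rfl, he'⟩ : ∃ e', w₁ = c ++ b :: e' ∧ e' ++ j :: w₂ = s' := by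
          rcases List.append_eq_append_iff.1 hw' with ⟨e', rfl, he⟩ | ⟨e', rfl, he⟩
          · simp at hc hw₁
          · rcases e' with _ | ⟨x', e'⟩
            · simp at hw₁
            · simp only [List.cons_append, List.cons.injEq] at he
              obtain ⟨rfl, rfl⟩ := he
              exact ⟨e', rfl, rfl⟩
        have hy' : y ∈ monSpan d (fun _ => True) a' := by
          have := add_mem (monSpan_mono (Q := fun _ => True) (fun _ _ _ => trivial) hbase)
            (diffMon_mem_monSpan (d := d) (P := fun _ => True) (z := bw p q) (a := a')
              (by rw [h', length_bw]) trivial)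
          rwa [sub_add_cancel] at this
        refine mul_mul_mem_monSpan (hw₁.trans h₁.symm) (hw₂.trans h₂.symm) (fun z hl _ => ?_)
          (pow_map_mem_monSpan (P := fun _ _ => True) hd (fun _ _ _ _ _ => trivial) hy' j)
        exact ⟨c, x, b, e ++ bw p q ++ u₂, e' ++ z ++ w₂, by simp, by simp, hlt⟩
      -- First difference at the contracted letter `0`: a smaller letter `j` satisfies `0 < j ≤
      -- topZeros`, which forces `q = 0`.
      · obtain ⟨rfl, h3⟩ := List.append_inj hu' hc.symm
        obtain ⟨rfl, h4⟩ := List.append_inj hw' hw₁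
        simp only [List.cons.injEq] at h3 h4
        obtain ⟨rfl, rfl⟩ := h3
        obtain ⟨rfl, rfl⟩ := h4
        obtain ⟨hj, hj'⟩ : 0 < j ∧ j ≤ topZeros w₁ := by omega
        obtain rfl : q = 0 := by
          by_contra hq
          have := hz2 (Nat.pos_of_ne_zero hq)
          omega
        have h5 := pow_diffEval_baseTree_mem hd p j a' h'
        refine mul_mul_mem_monSpan h₁.symm (hw₂.trans h₂.symm) (fun z hl hz => ?_) h5
        exact Less.of_append _ _ (exists_less_of_bounded hz1 hj hj' (hl.trans h') hz.1 hz.2)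
      -- First difference to the right: `y` is not differentiated, and its leading word `v` leaves
      -- `topZeros` before the difference unchanged.
      · obtain ⟨e, rfl, he⟩ : ∃ e, c = u₁ ++ 0 :: e ∧ u₂ = e ++ x :: s := by
          rcases List.append_eq_append_iff.1 hu' with ⟨e, rfl, he⟩ | ⟨e, rfl, he⟩
          · rcases e with _ | ⟨x', e⟩
            · simp at hc
            · simp only [List.cons_append, List.cons.injEq] at he
              obtain ⟨rfl, rfl⟩ := he
              exact ⟨e, rfl, rfl⟩
          · simp at hc
        rw [List.append_assoc] at hw'
        obtain ⟨rfl, h4⟩ := List.append_inj hw' hw₁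
        simp only [List.cons_append, List.cons.injEq] at h4
        obtain ⟨rfl, rfl⟩ := h4
        subst he
        have h5 : ∀ z, w₁ ++ z ++ (e ++ b :: s') = w₁ ++ z ++ e ++ b :: s' := by simp
        have h6 := mul_mul_mem_monSpan h₁.symm (hw₂.trans h₂.symm)
          (Q := (Less · (w₁ ++ bw p q ++ (e ++ x :: s))))
          (fun z hl hz => hlow z hl hz (e ++ b :: s')) hbase
        have h7 := diffMon_mem_monSpan (d := d) (P := (Less · (w₁ ++ bw p q ++ (e ++ x :: s))))
          (z := w₁ ++ bw p q ++ (e ++ b :: s')) (a := a₁ ++ a' ++ a₂)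
          (by simp [h₁, h', length_bw] at *; omega)
          ⟨w₁ ++ bw p q ++ e, x, b, s, s', by simp, by simp, by
            rw [topZeros_append_bw hN hpq]; simpa using hlt⟩
        have h8 := add_mem h6 h7
        rw [diffMon_append d (by simp [h₁, h', length_bw]), diffMon_append d h₁.symm, mul_sub,
          sub_mul, sub_add_cancel] at h8
        simpa using h8
    exact hsub hIH

end DiffWord

/-! ### Normal trees -/

namespace OpTree

variable {X : Type u}

/-- The labels of the leaves from left to right. -/
def leaves : OpTree X → List X
  | leaf x => [x]
  | prec l r => leaves l ++ leaves r
  | succ l r => leaves l ++ leaves r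

theorem length_leaves (t : OpTree X) : t.leaves.length = t.numLeaves := by
  induction t <;> simp_all [leaves, numLeaves]

theorem length_leaves_pos (t : OpTree X) : 0 < t.leaves.length := by
  induction t <;> simp_all [leaves]

/-- All inner vertices are labelled by `≻`. -/
inductive IsSucc : OpTree X → Prop
  | leaf (x : X) : IsSucc (leaf x)
  | succ {l r : OpTree X} : IsSucc l → IsSucc r → IsSucc (succ l r)

/-- All inner vertices are labelled by `≺`. -/
inductive IsPrec : OpTree X → Prop
  | leaf (x : X) : IsPrec (leaf x)
  | prec {l r : OpTree X} : IsPrec l → IsPrec r → IsPrec (prec l r)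

/-- The trees `(⋯((t ≻ c₁) ≻ c₂) ⋯) ≻ c_k`, where all inner vertices of `t` are labelled by `≺`
and all inner vertices of the `c_i` are labelled by `≻`. -/
inductive IsFactor : OpTree X → Prop
  | prec {t : OpTree X} : IsPrec t → IsFactor t
  | succ {b c : OpTree X} : IsFactor b → IsSucc c → IsFactor (succ b c)

/-- The trees `(⋯((c ≺ b₁) ≺ b₂) ⋯) ≺ b_k`, where all inner vertices of `c` are labelled by `≻`
and the `b_i` are factors. -/
inductive IsNormal : OpTree X → Prop
  | succ {t : OpTree X} : IsSucc t → IsNormal t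
  | prec {t b : OpTree X} : IsNormal t → IsFactor b → IsNormal (prec t b)

theorem IsSucc.isFactor {t : OpTree X} (h : IsSucc t) : IsFactor t := by
  induction h with
  | leaf x => exact .prec (.leaf x)
  | succ _ hr ihl _ => exact .succ ihl hr

end OpTree

/-! ### Reduction of monomials to normal trees -/

namespace NNovAlgebra

open OpTree MulOpposite

section

variable {𝕜 : Type u} {A : Type v} [CommRing 𝕜] [AddCommGroup A] [Module 𝕜 A] [NNovAlgebra 𝕜 A]

local notation "𝖯" => NNovAlgebra.prec (𝕜 := 𝕜)
local notation "𝖲" => NNovAlgebra.succ (𝕜 := 𝕜)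

variable (𝕜) in
/-- The operators `a ≻ ·` and `· ≺ a`. -/
def actions : A →ₗ[𝕜] Module.End 𝕜 A × (Module.End 𝕜 A)ᵐᵒᵖ :=
  LinearMap.prod 𝖲 ((opLinearEquiv 𝕜).toLinearMap ∘ₗ (𝖯 : A →ₗ[𝕜] A →ₗ[𝕜] A).flip)

theorem actions_fst (a e : A) : (actions 𝕜 a).1 e = 𝖲 a e := rfl

theorem actions_snd (a e : A) : (actions 𝕜 a).2.unop e = 𝖯 e a := rfl

theorem succ_prec_eq (a b c : A) :
    𝖲 (𝖯 a b) c = 𝖲 a (𝖲 b c) + 𝖯 a (𝖲 b c) - 𝖯 (𝖯 a b) c := by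
  have := prec_succ (𝕜 := 𝕜) a b c
  rw [sub_eq_iff_eq_add] at this
  rw [this]; abel

theorem prec_succ_eq (a b c : A) :
    𝖯 a (𝖲 b c) = 𝖲 (𝖯 a b) c + 𝖯 (𝖯 a b) c - 𝖲 a (𝖲 b c) := by
  rw [succ_prec_eq]; abel

/-- Lets left and right multiplications be reduced at once, to operators of shorter trees. The
opposite algebra in the second component keeps the factors of a product in the order of the leaves.
-/
theorem actions_succ_prec (a b c : A) :
    actions 𝕜 (𝖯 (𝖲 a b) c) = actions 𝕜 (𝖲 a b) * actions 𝕜 c + actions 𝕜 a * actions 𝕜 (𝖯 b c)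
      - actions 𝕜 a * actions 𝕜 b * actions 𝕜 c := by
  refine Prod.ext (LinearMap.ext fun e => ?_) (unop_injective (LinearMap.ext fun e => ?_))
  · change 𝖲 (𝖯 (𝖲 a b) c) e = 𝖲 (𝖲 a b) (𝖲 c e) + 𝖲 a (𝖲 (𝖯 b c) e) - 𝖲 a (𝖲 b (𝖲 c e))
    rw [succ_prec_eq (𝖲 a b), succ_prec_eq b c e]
    simp only [map_add, map_sub, succ_prec]
    abel
  · change 𝖯 e (𝖯 (𝖲 a b) c) = 𝖯 (𝖯 e (𝖲 a b)) c + 𝖯 (𝖯 e a) (𝖯 b c) - 𝖯 (𝖯 (𝖯 e a) b) c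
    rw [← succ_prec, prec_succ_eq e a, succ_prec, prec_succ_eq e a b, succ_prec, succ_prec]
    simp only [map_add, map_sub, LinearMap.add_apply, LinearMap.sub_apply]
    abel

end

variable (𝕜 : Type u) {X : Type v} {A : Type w} [CommRing 𝕜] [AddCommGroup A] [Module 𝕜 A]
  [NNovAlgebra 𝕜 A] (f : X → A)

local notation "𝖯" => NNovAlgebra.prec (𝕜 := 𝕜)
local notation "𝖲" => NNovAlgebra.succ (𝕜 := 𝕜)

/-- The span of the values of the trees with given leaves that satisfy `P`. -/
def treeSpan (P : OpTree X → Prop) (L : List X) : Submodule 𝕜 A :=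
  Submodule.span 𝕜 {y | ∃ t, P t ∧ t.leaves = L ∧ y = t.eval 𝕜 f}

variable {𝕜 f}

theorem eval_mem_treeSpan {P : OpTree X → Prop} {L : List X} {t : OpTree X} (h : P t)
    (hL : t.leaves = L) : t.eval 𝕜 f ∈ treeSpan 𝕜 f P L :=
  Submodule.subset_span ⟨t, h, hL, rfl⟩

theorem treeSpan_induction {M : Type*} [AddCommGroup M] [Module 𝕜 M] {P : OpTree X → Prop}
    {L : List X} (N : Submodule 𝕜 M) (g : A →ₗ[𝕜] M)
    (h : ∀ t, P t → t.leaves = L → g (t.eval 𝕜 f) ∈ N) {y : A} (hy : y ∈ treeSpan 𝕜 f P L) :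
    g y ∈ N := by
  have : treeSpan 𝕜 f P L ≤ N.comap g := by
    refine Submodule.span_le.2 ?_
    rintro _ ⟨t, ht, hL, rfl⟩
    exact h t ht hL
  exact this hy

variable (𝕜 f) in
-- The second clause drives the induction: up to trees with root `≺`, `(p ≺ q) ≻ t` equals `p ≻ (q ≻
-- t)` with shorter `p` and `q`, while `u ≻ (p ≺ q) = (u ≻ p) ≺ q` already has root `≺`.
theorem eval_mem_treeSpan_succ_or_prec (u : OpTree X) :
    u.eval 𝕜 f ∈ treeSpan 𝕜 f (fun t => IsSucc t ∨ ∃ p q, t = .prec p q) u.leaves ∧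
    ∀ (L : List X) (y : A), y ∈ treeSpan 𝕜 f (fun t => IsSucc t ∨ ∃ p q, t = .prec p q) L →
      𝖲 (u.eval 𝕜 f) y ∈ treeSpan 𝕜 f (fun t => IsSucc t ∨ ∃ p q, t = .prec p q)
        (u.leaves ++ L) := by
  induction hn : u.leaves.length using Nat.strong_induction_on generalizing u with
  | _ n ih =>
  have h1 : u.eval 𝕜 f ∈ treeSpan 𝕜 f (fun t => IsSucc t ∨ ∃ p q, t = .prec p q) u.leaves := by
    cases u with
    | leaf x => exact eval_mem_treeSpan (.inl (.leaf x)) rfl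
    | prec p q => exact eval_mem_treeSpan (.inr ⟨p, q, rfl⟩) rfl
    | succ p q =>
      have hp := p.length_leaves_pos
      have hq := q.length_leaves_pos
      simp only [leaves, List.length_append] at hn
      exact (ih _ (by omega) p rfl).2 _ _ (ih _ (by omega) q rfl).1
  refine ⟨h1, fun L y hy => ?_⟩
  refine treeSpan_induction (𝕜 := 𝕜) _ (LinearMap.flip 𝖲 y) (fun u' hu' hL => ?_) h1
  rw [LinearMap.flip_apply]
  refine treeSpan_induction (𝕜 := 𝕜) _ (𝖲 (u'.eval 𝕜 f)) (fun t ht hL' => ?_) hy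
  rw [← hL, ← hL']
  rw [← hL] at hn
  rcases ht with ht | ⟨p, q, rfl⟩
  · rcases hu' with hu' | ⟨p, q, rfl⟩
    · exact eval_mem_treeSpan (t := .succ u' t) (.inl (.succ hu' ht)) rfl
    · have hp := p.length_leaves_pos
      have hq := q.length_leaves_pos
      simp only [leaves, List.length_append] at hn
      rw [OpTree.eval, succ_prec_eq, leaves, List.append_assoc]
      refine sub_mem (add_mem ?_ ?_) ?_
      · refine (ih _ (by omega) p rfl).2 _ _ ((ih _ (by omega) q rfl).2 _ _ ?_)
        exact eval_mem_treeSpan (.inl ht) rfl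
      · exact eval_mem_treeSpan (t := .prec p (.succ q t)) (.inr ⟨_, _, rfl⟩) rfl
      · exact eval_mem_treeSpan (t := .prec (.prec p q) t) (.inr ⟨_, _, rfl⟩)
          (by simp [leaves])
  · rw [OpTree.eval, succ_prec]
    exact eval_mem_treeSpan (t := .prec (.succ u' p) q) (.inr ⟨_, _, rfl⟩) (by simp [leaves])

variable (𝕜 f) in
-- Mirror image of the preceding result: the defining identities are stable under reversing products
-- and exchanging `≺` with `≻`.
theorem eval_mem_treeSpan_prec_or_succ (u : OpTree X) :
    u.eval 𝕜 f ∈ treeSpan 𝕜 f (fun t => IsPrec t ∨ ∃ p q, t = .succ p q) u.leaves ∧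
    ∀ (L : List X) (y : A), y ∈ treeSpan 𝕜 f (fun t => IsPrec t ∨ ∃ p q, t = .succ p q) L →
      𝖯 y (u.eval 𝕜 f) ∈ treeSpan 𝕜 f (fun t => IsPrec t ∨ ∃ p q, t = .succ p q)
        (L ++ u.leaves) := by
  induction hn : u.leaves.length using Nat.strong_induction_on generalizing u with
  | _ n ih =>
  have h1 : u.eval 𝕜 f ∈ treeSpan 𝕜 f (fun t => IsPrec t ∨ ∃ p q, t = .succ p q) u.leaves := by
    cases u with
    | leaf x => exact eval_mem_treeSpan (.inl (.leaf x)) rfl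
    | succ p q => exact eval_mem_treeSpan (.inr ⟨p, q, rfl⟩) rfl
    | prec p q =>
      have hp := p.length_leaves_pos
      have hq := q.length_leaves_pos
      simp only [leaves, List.length_append] at hn
      exact (ih _ (by omega) q rfl).2 _ _ (ih _ (by omega) p rfl).1
  refine ⟨h1, fun L y hy => ?_⟩
  refine treeSpan_induction (𝕜 := 𝕜) _ (𝖯 y) (fun u' hu' hL => ?_) h1
  refine treeSpan_induction (𝕜 := 𝕜) _ (LinearMap.flip 𝖯 (u'.eval 𝕜 f)) (fun t ht hL' => ?_) hy
  rw [LinearMap.flip_apply, ← hL, ← hL']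
  rw [← hL] at hn
  rcases ht with ht | ⟨p, q, rfl⟩
  · rcases hu' with hu' | ⟨p, q, rfl⟩
    · exact eval_mem_treeSpan (t := .prec t u') (.inl (.prec ht hu')) rfl
    · have hp := p.length_leaves_pos
      have hq := q.length_leaves_pos
      simp only [leaves, List.length_append] at hn
      rw [OpTree.eval.eq_def 𝕜 f (OpTree.succ p q), prec_succ_eq, leaves, ← List.append_assoc]
      refine sub_mem (add_mem ?_ ?_) ?_
      · exact eval_mem_treeSpan (t := .succ (.prec t p) q) (.inr ⟨_, _, rfl⟩) rfl
      · refine (ih _ (by omega) q rfl).2 _ _ ((ih _ (by omega) p rfl).2 _ _ ?_)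
        exact eval_mem_treeSpan (.inl ht) rfl
      · exact eval_mem_treeSpan (t := .succ t (.succ p q)) (.inr ⟨_, _, rfl⟩)
          (by simp [leaves])
  · rw [OpTree.eval.eq_def 𝕜 f (OpTree.succ p q), ← succ_prec]
    exact eval_mem_treeSpan (t := .succ p (.prec q u')) (.inr ⟨_, _, rfl⟩) (by simp [leaves])

variable (𝕜 f) in
/-- The span of the products of the operators defined by factors with given leaves. -/
def factorSpan (L : List X) : Submodule 𝕜 (Module.End 𝕜 A × (Module.End 𝕜 A)ᵐᵒᵖ) :=
  Submodule.span 𝕜 {σ | ∃ bs : List (OpTree X), (∀ b ∈ bs, IsFactor b) ∧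
    bs.flatMap leaves = L ∧ σ = (bs.map fun b => actions 𝕜 (b.eval 𝕜 f)).prod}

theorem actions_mem_factorSpan {b : OpTree X} {L : List X} (hb : IsFactor b)
    (hL : b.leaves = L) : actions 𝕜 (b.eval 𝕜 f) ∈ factorSpan 𝕜 f L :=
  Submodule.subset_span ⟨[b], by simpa using hb, by simpa using hL, by simp⟩

theorem factorSpan_induction {M : Type*} [AddCommGroup M] [Module 𝕜 M] {L : List X}
    (N : Submodule 𝕜 M) (g : Module.End 𝕜 A × (Module.End 𝕜 A)ᵐᵒᵖ →ₗ[𝕜] M)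
    (h : ∀ bs : List (OpTree X), (∀ b ∈ bs, IsFactor b) → bs.flatMap leaves = L →
      g (bs.map fun b => actions 𝕜 (b.eval 𝕜 f)).prod ∈ N)
    {σ : Module.End 𝕜 A × (Module.End 𝕜 A)ᵐᵒᵖ} (hσ : σ ∈ factorSpan 𝕜 f L) : g σ ∈ N := by
  have : factorSpan 𝕜 f L ≤ N.comap g := by
    refine Submodule.span_le.2 ?_
    rintro _ ⟨bs, hbs, hL, rfl⟩
    exact h bs hbs hL
  exact this hσ

theorem mul_mem_factorSpan {L L' : List X} {σ τ : Module.End 𝕜 A × (Module.End 𝕜 A)ᵐᵒᵖ}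
    (hσ : σ ∈ factorSpan 𝕜 f L) (hτ : τ ∈ factorSpan 𝕜 f L') :
    σ * τ ∈ factorSpan 𝕜 f (L ++ L') := by
  refine factorSpan_induction (factorSpan 𝕜 f (L ++ L')) (LinearMap.mulRight 𝕜 τ)
    (fun bs hbs hL => ?_) hσ
  rw [LinearMap.mulRight_apply]
  refine factorSpan_induction (factorSpan 𝕜 f (L ++ L')) (LinearMap.mulLeft 𝕜 _)
    (fun bs' hbs' hL' => ?_) hτ
  rw [LinearMap.mulLeft_apply]
  refine Submodule.subset_span ⟨bs ++ bs', ?_, ?_, ?_⟩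
  · simp only [List.mem_append]
    rintro b (hb | hb)
    exacts [hbs b hb, hbs' b hb]
  · rw [List.flatMap_append, hL, hL']
  · rw [List.map_append, List.prod_append]

end NNovAlgebra

namespace NNovAlgebra

open OpTree MulOpposite

variable {𝕜 : Type u} {X : Type v} {A : Type w} [CommRing 𝕜] [AddCommGroup A] [Module 𝕜 A]
  [NNovAlgebra 𝕜 A] {f : X → A}

local notation "𝖯" => NNovAlgebra.prec (𝕜 := 𝕜)
local notation "𝖲" => NNovAlgebra.succ (𝕜 := 𝕜)

section Normalize

variable {n : ℕ}
  (ih : ∀ t : OpTree X, t.leaves.length < n → actions 𝕜 (t.eval 𝕜 f) ∈ factorSpan 𝕜 f t.leaves)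
include ih

/-- Every operator on the right of `actions_succ_prec` belongs to a tree with fewer than `n` leaves.
-/
theorem actions_succ_prec_mem (a b c : OpTree X) {L : List X}
    (hL : a.leaves ++ b.leaves ++ c.leaves = L) (hn : L.length = n) :
    actions 𝕜 (𝖲 (a.eval 𝕜 f) (𝖯 (b.eval 𝕜 f) (c.eval 𝕜 f))) ∈ factorSpan 𝕜 f L := by
  subst hL
  have ha := a.length_leaves_pos
  have hb := b.length_leaves_pos
  have hc := c.length_leaves_pos
  simp only [List.length_append] at hn
  rw [succ_prec, actions_succ_prec]
  refine sub_mem (add_mem ?_ ?_) ?_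
  · exact mul_mem_factorSpan (ih (.succ a b) (by simp [leaves]; omega)) (ih c (by omega))
  · rw [List.append_assoc]
    exact mul_mem_factorSpan (ih a (by omega)) (ih (.prec b c) (by simp [leaves]; omega))
  · exact mul_mem_factorSpan (mul_mem_factorSpan (ih a (by omega)) (ih b (by omega)))
      (ih c (by omega))

/-- Expand `t`: a pure `≻`-tree gives a factor, a tree with root `≺` falls under
`actions_succ_prec_mem`. -/
theorem actions_factor_succ_mem (b t : OpTree X) (hb : IsFactor b) {L : List X}
    (hL : b.leaves ++ t.leaves = L) (hn : L.length = n) :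
    actions 𝕜 (𝖲 (b.eval 𝕜 f) (t.eval 𝕜 f)) ∈ factorSpan 𝕜 f L := by
  refine treeSpan_induction (𝕜 := 𝕜) _ (actions 𝕜 ∘ₗ 𝖲 (b.eval 𝕜 f)) (fun t' ht' hL' => ?_)
    (eval_mem_treeSpan_succ_or_prec 𝕜 f t).1
  rw [LinearMap.comp_apply]
  rw [← hL'] at hL
  rcases ht' with ht' | ⟨p, q, rfl⟩
  · exact actions_mem_factorSpan (b := .succ b t') (.succ hb ht') hL
  · exact actions_succ_prec_mem ih b p q (by rw [← hL, leaves, List.append_assoc]) hn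

/-- By induction `a ≻ ·` is a combination of products of operators `b ≻ ·` of factors. All but the
outermost are absorbed into the right argument. -/
theorem actions_succ_mem (a t : OpTree X) {L : List X}
    (hL : a.leaves ++ t.leaves = L) (hn : L.length = n) :
    actions 𝕜 (𝖲 (a.eval 𝕜 f) (t.eval 𝕜 f)) ∈ factorSpan 𝕜 f L := by
  subst hL
  have ht := t.length_leaves_pos
  have ha' := a.length_leaves_pos
  have ha := ih a (by simp at hn; omega)
  rw [← actions_fst]
  refine factorSpan_induction (f := f) (factorSpan 𝕜 f (a.leaves ++ t.leaves))
    (actions 𝕜 ∘ₗ LinearMap.applyₗ (t.eval 𝕜 f) ∘ₗ LinearMap.fst 𝕜 _ _) (fun bs hbs hL => ?_) ha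
  simp only [LinearMap.comp_apply, LinearMap.fst_apply, LinearMap.applyₗ_apply_apply]
  have key : ∀ bs : List (OpTree X), ∃ s : OpTree X, s.leaves = bs.flatMap leaves ++ t.leaves ∧
      s.eval 𝕜 f = ((bs.map fun b => actions 𝕜 (b.eval 𝕜 f)).prod).1 (t.eval 𝕜 f) := by
    intro bs
    induction bs with
    | nil => exact ⟨t, by simp, by simp⟩
    | cons b bs ihb =>
      obtain ⟨s, hs, hs'⟩ := ihb
      refine ⟨.succ b s, by simp [leaves, hs], ?_⟩
      rw [OpTree.eval, hs', List.map_cons, List.prod_cons, Prod.fst_mul, Module.End.mul_apply,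
        actions_fst]
  rcases bs with _ | ⟨b, bs⟩
  · simp at hL
    simp [hL] at ha'
  · obtain ⟨s, hs, hs'⟩ := key bs
    rw [List.map_cons, List.prod_cons, Prod.fst_mul, Module.End.mul_apply, actions_fst, ← hs']
    refine actions_factor_succ_mem ih b s (hbs b (by simp)) ?_ hn
    rw [hs, ← hL]
    simp

/-- The critical case is `a ≺ (b ≻ c)`. The second identity yields two terms with root `≻` and `(a ≺
b) ≺ c`, whose right argument `c` is a shorter factor. -/
theorem actions_prec_factor_mem (a b : OpTree X) (hb : IsFactor b) {L : List X}
    (hL : a.leaves ++ b.leaves = L) (hn : L.length = n) :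
    actions 𝕜 (𝖯 (a.eval 𝕜 f) (b.eval 𝕜 f)) ∈ factorSpan 𝕜 f L := by
  induction hk : b.leaves.length using Nat.strong_induction_on generalizing a b with
  | _ k ihk =>
  refine treeSpan_induction (𝕜 := 𝕜) _ (actions 𝕜 ∘ₗ LinearMap.flip 𝖯 (b.eval 𝕜 f))
    (fun a' ha' hL' => ?_) (eval_mem_treeSpan_prec_or_succ 𝕜 f a).1
  rw [LinearMap.comp_apply, LinearMap.flip_apply]
  rw [← hL'] at hL
  rcases ha' with ha' | ⟨p, q, rfl⟩
  · cases hb with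
    | prec hb => exact actions_mem_factorSpan (b := .prec a' b) (.prec (.prec ha' hb)) hL
    | @succ b c hb hc =>
      rw [OpTree.eval.eq_def 𝕜 f (OpTree.succ b c), prec_succ_eq, map_sub, map_add]
      rw [leaves, ← List.append_assoc] at hL
      refine sub_mem (add_mem ?_ ?_) ?_
      · exact actions_succ_mem ih (.prec a' b) c hL hn
      · refine ihk _ ?_ (.prec a' b) c hc.isFactor hL rfl
        have := b.length_leaves_pos
        simp only [leaves, List.length_append] at hk
        omega
      · exact actions_succ_mem ih a' (.succ b c) (by rw [← hL, leaves, List.append_assoc]) hn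
  · rw [OpTree.eval.eq_def 𝕜 f (OpTree.succ p q), ← succ_prec]
    exact actions_succ_prec_mem ih p q b hL hn

/-- As in `actions_succ_mem`, with the last factor outermost and the others absorbed into the left
argument. -/
theorem actions_prec_mem (a t : OpTree X) {L : List X}
    (hL : a.leaves ++ t.leaves = L) (hn : L.length = n) :
    actions 𝕜 (𝖯 (a.eval 𝕜 f) (t.eval 𝕜 f)) ∈ factorSpan 𝕜 f L := by
  subst hL
  have ht' := t.length_leaves_pos
  have ha := a.length_leaves_pos
  have ht := ih t (by simp at hn; omega)
  rw [← actions_snd]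
  refine factorSpan_induction (f := f) (factorSpan 𝕜 f (a.leaves ++ t.leaves))
    (actions 𝕜 ∘ₗ LinearMap.applyₗ (a.eval 𝕜 f) ∘ₗ (opLinearEquiv 𝕜).symm.toLinearMap ∘ₗ
      LinearMap.snd 𝕜 _ _) (fun bs hbs hL => ?_) ht
  change actions 𝕜 ((bs.map fun b => actions 𝕜 (b.eval 𝕜 f)).prod.2.unop (a.eval 𝕜 f)) ∈ _
  have key : ∀ bs : List (OpTree X), ∃ s : OpTree X, s.leaves = a.leaves ++ bs.flatMap leaves ∧
      s.eval 𝕜 f = (bs.map fun b => actions 𝕜 (b.eval 𝕜 f)).prod.2.unop (a.eval 𝕜 f) := by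
    intro bs
    induction bs using List.reverseRecOn with
    | nil => exact ⟨a, by simp, by simp⟩
    | append_singleton bs b ihb =>
      obtain ⟨s, hs, hs'⟩ := ihb
      refine ⟨.prec s b, by simp [leaves, hs], ?_⟩
      rw [OpTree.eval, hs', List.map_append, List.prod_append, Prod.snd_mul, unop_mul,
        Module.End.mul_apply, List.map_singleton, List.prod_singleton, actions_snd]
  rcases List.eq_nil_or_concat bs with rfl | ⟨bs, b, rfl⟩
  · simp at hL
    simp [hL] at ht'
  · obtain ⟨s, hs, hs'⟩ := key bs
    rw [List.concat_eq_append] at hbs hL ⊢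
    rw [List.map_append, List.prod_append, Prod.snd_mul, unop_mul,
        Module.End.mul_apply, List.map_singleton, List.prod_singleton, actions_snd, ← hs']
    refine actions_prec_factor_mem ih s b (hbs b (by simp)) ?_ hn
    rw [hs, ← hL]
    simp

end Normalize

variable (𝕜 f) in
theorem actions_eval_mem_factorSpan (t : OpTree X) :
    actions 𝕜 (t.eval 𝕜 f) ∈ factorSpan 𝕜 f t.leaves := by
  induction hn : t.leaves.length using Nat.strong_induction_on generalizing t with
  | _ n ih =>
  have ih' : ∀ t : OpTree X, t.leaves.length < n →
      actions 𝕜 (t.eval 𝕜 f) ∈ factorSpan 𝕜 f t.leaves := fun t ht => ih _ ht t rfl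
  cases t with
  | leaf x => exact actions_mem_factorSpan (.prec (.leaf x)) rfl
  | prec a t => exact actions_prec_mem ih' a t rfl hn
  | succ a t => exact actions_succ_mem ih' a t rfl hn

variable (𝕜 f) in
/-- The values of the normal trees with given leaves span those of all trees. -/
theorem eval_mem_treeSpan_isNormal (t : OpTree X) :
    t.eval 𝕜 f ∈ treeSpan 𝕜 f IsNormal t.leaves := by
  induction hn : t.leaves.length using Nat.strong_induction_on generalizing t with
  | _ n ih =>
  refine treeSpan_induction (𝕜 := 𝕜) _ LinearMap.id (fun t' ht' hL => ?_)
    (eval_mem_treeSpan_succ_or_prec 𝕜 f t).1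
  rw [LinearMap.id_apply]
  rw [← hL] at hn ⊢
  rcases ht' with ht' | ⟨p, q, rfl⟩
  · exact eval_mem_treeSpan (.succ ht') rfl
  · have hq := q.length_leaves_pos
    have hp := ih p.leaves.length (by simp [leaves] at hn; omega) p rfl
    rw [OpTree.eval, leaves, ← actions_snd]
    -- The operator `· ≺ q` is a combination of successive multiplications `· ≺ b` by factors, and
    -- these preserve normal trees.
    refine factorSpan_induction (f := f) (treeSpan 𝕜 f IsNormal (p.leaves ++ q.leaves))
      (LinearMap.applyₗ (p.eval 𝕜 f) ∘ₗ (opLinearEquiv 𝕜).symm.toLinearMap ∘ₗ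
        LinearMap.snd 𝕜 _ _) (fun bs hbs hL => ?_) (actions_eval_mem_factorSpan 𝕜 f q)
    rw [← hL]
    change (bs.map fun b => actions 𝕜 (b.eval 𝕜 f)).prod.2.unop (p.eval 𝕜 f) ∈ _
    clear hL
    induction bs using List.reverseRecOn with
    | nil => simpa using hp
    | append_singleton bs b ihb =>
      rw [List.map_append, List.prod_append, Prod.snd_mul, unop_mul, Module.End.mul_apply,
        List.map_singleton, List.prod_singleton, actions_snd]
      refine treeSpan_induction (𝕜 := 𝕜) _ (LinearMap.flip 𝖯 (b.eval 𝕜 f)) (fun s hs hL => ?_)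
        (ihb fun b hb => hbs b (by simp [hb]))
      rw [LinearMap.flip_apply]
      exact eval_mem_treeSpan (t := .prec s b) (.prec hs (hbs b (by simp)))
        (by simp [leaves, hL])

end NNovAlgebra

/-! ### Normal trees as balanced paths -/

namespace OpTree

theorem numLeaves_map {X : Type u} {Y : Type v} (g : X → Y) (t : OpTree X) :
    (t.map g).numLeaves = t.numLeaves := by
  induction t <;> simp_all [map, numLeaves]

theorem IsSucc.shape {X : Type u} {t : OpTree X} (h : IsSucc t) : IsSucc t.shape := by
  induction h with
  | leaf x => exact .leaf _
  | succ _ _ hl hr => exact .succ hl hr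

theorem IsPrec.shape {X : Type u} {t : OpTree X} (h : IsPrec t) : IsPrec t.shape := by
  induction h with
  | leaf x => exact .leaf _
  | prec _ _ hl hr => exact .prec hl hr

theorem IsFactor.shape {X : Type u} {t : OpTree X} (h : IsFactor t) : IsFactor t.shape := by
  induction h with
  | prec h => exact .prec h.shape
  | succ _ hc hb => exact .succ hb hc.shape

theorem IsNormal.shape {X : Type u} {t : OpTree X} (h : IsNormal t) : IsNormal t.shape := by
  induction h with
  | succ h => exact .succ h.shape
  | prec _ hb ht => exact .prec ht hb.shape

theorem eq_of_shape_eq {X : Type u} {t t' : OpTree X} (h : t.shape = t'.shape)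
    (hl : t.leaves = t'.leaves) : t = t' := by
  have key : ∀ {l r l' r' : OpTree X}, l.shape = l'.shape → l.leaves ++ r.leaves =
      l'.leaves ++ r'.leaves → l.leaves = l'.leaves ∧ r.leaves = r'.leaves := by
    intro l r l' r' h hlr
    refine List.append_inj hlr ?_
    rw [length_leaves, length_leaves, ← numLeaves_map (fun _ => ()) l,
      ← numLeaves_map (fun _ => ()) l']
    exact congrArg numLeaves h
  induction t generalizing t' with
  | leaf x => cases t' <;> simp_all [OpTree.shape, map, leaves]
  | prec l r ihl ihr =>
    cases t' with
    | prec l' r' =>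
      simp only [OpTree.shape, map, prec.injEq] at h
      obtain ⟨h1, h2⟩ := key (show l.shape = l'.shape from h.1) hl
      rw [ihl h.1 h1, ihr h.2 h2]
    | _ => simp [OpTree.shape, map] at h
  | succ l r ihl ihr =>
    cases t' with
    | succ l' r' =>
      simp only [OpTree.shape, map, succ.injEq] at h
      obtain ⟨h1, h2⟩ := key (show l.shape = l'.shape from h.1) hl
      rw [ihl h.1 h1, ihr h.2 h2]
    | _ => simp [OpTree.shape, map] at h

/-- The Dyck path of a tree with all inner vertices labelled by `≻`. -/
def succPath : OpTree Unit → List Bool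
  | succ l r => true :: (succPath l ++ false :: succPath r)
  | _ => []

/-- The negative Dyck path of a tree with all inner vertices labelled by `≺`. -/
def precPath : OpTree Unit → List Bool
  | prec l r => false :: (precPath l ++ true :: precPath r)
  | _ => []

/-- The balanced path of a factor. -/
def factorPath : OpTree Unit → List Bool
  | succ b c => factorPath b ++ (true :: (succPath c ++ [false]))
  | t => false :: (precPath t ++ [true])

/-- The balanced path of a normal tree. -/
def normalPath : OpTree Unit → List Bool
  | prec t b => normalPath t ++ factorPath b
  | t => succPath t

/-- The remainders let the induction pass through concatenations: at ground level a Dyck path ends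
where no up step follows. -/
theorem succPath_inj {t t' : OpTree Unit} (ht : IsSucc t) (ht' : IsSucc t') {r r' : List Bool}
    (hr : r.head? ≠ some true) (hr' : r'.head? ≠ some true)
    (h : succPath t ++ r = succPath t' ++ r') : t = t' ∧ r = r' := by
  induction ht generalizing t' r r' with
  | leaf x =>
    cases ht' with
    | leaf y => exact ⟨rfl, h⟩
    | succ _ _ => simp [succPath] at h; simp [h] at hr
  | succ _ _ ihl ihr =>
    cases ht' with
    | leaf y => simp [succPath] at h; simp [← h] at hr'
    | succ hl' hr'' =>
      simp only [succPath, List.cons_append, List.append_assoc, List.cons.injEq, true_and] at h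
      obtain ⟨rfl, h1⟩ := ihl hl' (by simp) (by simp) h
      obtain ⟨rfl, h2⟩ := ihr hr'' hr hr' (List.cons.inj h1).2
      exact ⟨rfl, h2⟩

theorem precPath_inj {t t' : OpTree Unit} (ht : IsPrec t) (ht' : IsPrec t') {r r' : List Bool}
    (hr : r.head? ≠ some false) (hr' : r'.head? ≠ some false)
    (h : precPath t ++ r = precPath t' ++ r') : t = t' ∧ r = r' := by
  induction ht generalizing t' r r' with
  | leaf x =>
    cases ht' with
    | leaf y => exact ⟨rfl, h⟩
    | prec _ _ => simp [precPath] at h; simp [h] at hr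
  | prec _ _ ihl ihr =>
    cases ht' with
    | leaf y => simp [precPath] at h; simp [← h] at hr'
    | prec hl' hr'' =>
      simp only [precPath, List.cons_append, List.append_assoc, List.cons.injEq, true_and] at h
      obtain ⟨rfl, h1⟩ := ihl hl' (by simp) (by simp) h
      obtain ⟨rfl, h2⟩ := ihr hr'' hr hr' (List.cons.inj h1).2
      exact ⟨rfl, h2⟩

theorem flatMap_succPath_inj {cs cs' : List (OpTree Unit)} (hcs : ∀ c ∈ cs, IsSucc c)
    (hcs' : ∀ c ∈ cs', IsSucc c) {r r' : List Bool} (hr : r.head? ≠ some true)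
    (hr' : r'.head? ≠ some true)
    (h : cs.flatMap (fun c => true :: (succPath c ++ [false])) ++ r =
      cs'.flatMap (fun c => true :: (succPath c ++ [false])) ++ r') : cs = cs' ∧ r = r' := by
  induction cs generalizing cs' with
  | nil =>
    rcases cs' with _ | ⟨c', cs'⟩
    · exact ⟨rfl, h⟩
    · simp at h; simp [h] at hr
  | cons c cs ih =>
    rcases cs' with _ | ⟨c', cs'⟩
    · simp at h; simp [← h] at hr'
    · simp only [List.flatMap_cons, List.cons_append, List.append_assoc, List.cons.injEq,
        true_and, List.nil_append] at h
      obtain ⟨rfl, h1⟩ := succPath_inj (hcs c (by simp)) (hcs' c' (by simp)) (by simp) (by simp) h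
      obtain ⟨rfl, h2⟩ := ih (fun c hc => hcs c (by simp [hc])) (fun c hc => hcs' c (by simp [hc]))
        (List.cons.inj h1).2
      exact ⟨rfl, h2⟩

theorem factorPath_of_isPrec {t : OpTree Unit} (h : IsPrec t) :
    factorPath t = false :: (precPath t ++ [true]) := by
  cases h <;> rfl

theorem normalPath_of_isSucc {t : OpTree Unit} (h : IsSucc t) : normalPath t = succPath t := by
  cases h <;> rfl

theorem IsFactor.exists_foldl {b : OpTree Unit} (h : IsFactor b) :
    ∃ (t : OpTree Unit) (cs : List (OpTree Unit)), IsPrec t ∧ (∀ c ∈ cs, IsSucc c) ∧ b = cs.foldl OpTree.succ t ∧ factorPath b =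
      false :: (precPath t ++ true :: cs.flatMap (fun c => true :: (succPath c ++ [false]))) := by
  induction h with
  | prec h => exact ⟨_, [], h, by simp, rfl, by simp [factorPath_of_isPrec h]⟩
  | @succ b c _ hc ih =>
    obtain ⟨t, cs, ht, hcs, rfl, hp⟩ := ih
    refine ⟨t, cs ++ [c], ht, ?_, by simp, by simp [factorPath, hp]⟩
    simp only [List.mem_append, List.mem_singleton]
    rintro c' (h | rfl)
    exacts [hcs c' h, hc]

theorem IsNormal.exists_foldl {t : OpTree Unit} (h : IsNormal t) :
    ∃ (c : OpTree Unit) (bs : List (OpTree Unit)), IsSucc c ∧ (∀ b ∈ bs, IsFactor b) ∧ t = bs.foldl OpTree.prec c ∧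
      normalPath t = succPath c ++ bs.flatMap factorPath := by
  induction h with
  | succ h => exact ⟨_, [], h, by simp, rfl, by simp [normalPath_of_isSucc h]⟩
  | @prec t b _ hb ih =>
    obtain ⟨c, bs, hc, hbs, rfl, hp⟩ := ih
    refine ⟨c, bs ++ [b], hc, ?_, by simp, by simp [normalPath, hp]⟩
    simp only [List.mem_append, List.mem_singleton]
    rintro c' (h | rfl)
    exacts [hbs c' h, hb]

theorem head?_flatMap_factorPath {bs : List (OpTree Unit)} (hbs : ∀ b ∈ bs, IsFactor b) :
    (bs.flatMap factorPath).head? ≠ some true := by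
  rcases bs with _ | ⟨b, bs⟩
  · simp
  · obtain ⟨t, cs, -, -, -, h⟩ := (hbs b (by simp)).exists_foldl
    simp [h]

/-- A factor is one negative excursion from ground level followed by positive ones, so each negative
excursion marks the start of a new factor. -/
theorem flatMap_factorPath_inj {bs bs' : List (OpTree Unit)} (hbs : ∀ b ∈ bs, IsFactor b)
    (hbs' : ∀ b ∈ bs', IsFactor b) (h : bs.flatMap factorPath = bs'.flatMap factorPath) :
    bs = bs' := by
  induction bs generalizing bs' with
  | nil =>
    rcases bs' with _ | ⟨b', bs'⟩
    · rfl
    · obtain ⟨t', cs', -, -, -, hp'⟩ := (hbs' b' (by simp)).exists_foldl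
      simp [hp'] at h
  | cons b bs ih =>
    obtain ⟨t, cs, ht, hcs, hb, hp⟩ := (hbs b (by simp)).exists_foldl
    rcases bs' with _ | ⟨b', bs'⟩
    · simp [hp] at h
    · obtain ⟨t', cs', ht', hcs', hb', hp'⟩ := (hbs' b' (by simp)).exists_foldl
      have h1 : ∀ b ∈ bs, IsFactor b := fun b hb => hbs b (by simp [hb])
      have h1' : ∀ b ∈ bs', IsFactor b := fun b hb => hbs' b (by simp [hb])
      simp only [List.flatMap_cons, hp, hp', List.cons_append, List.append_assoc,
        List.cons.injEq, true_and] at h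
      obtain ⟨rfl, h3⟩ := precPath_inj ht ht' (by simp) (by simp) h
      obtain ⟨rfl, h4⟩ := flatMap_succPath_inj hcs hcs' (head?_flatMap_factorPath h1)
        (head?_flatMap_factorPath h1') (List.cons.inj h3).2
      rw [hb, hb', ih h1 h1' h4]

theorem normalPath_inj {t t' : OpTree Unit} (ht : IsNormal t) (ht' : IsNormal t')
    (h : normalPath t = normalPath t') : t = t' := by
  obtain ⟨c, bs, hc, hbs, rfl, hp⟩ := ht.exists_foldl
  obtain ⟨c', bs', hc', hbs', rfl, hp'⟩ := ht'.exists_foldl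
  rw [hp, hp'] at h
  obtain ⟨rfl, h1⟩ := succPath_inj hc hc' (head?_flatMap_factorPath hbs)
    (head?_flatMap_factorPath hbs') h
  rw [flatMap_factorPath_inj hbs hbs' h1]

theorem count_succPath {t : OpTree Unit} (h : IsSucc t) (b : Bool) :
    (succPath t).count b + 1 = t.numLeaves := by
  induction h with
  | leaf x => simp [succPath, numLeaves]
  | succ _ _ hl hr => cases b <;> simp [succPath, numLeaves] at * <;> omega

theorem count_precPath {t : OpTree Unit} (h : IsPrec t) (b : Bool) :
    (precPath t).count b + 1 = t.numLeaves := by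
  induction h with
  | leaf x => simp [precPath, numLeaves]
  | prec _ _ hl hr => cases b <;> simp [precPath, numLeaves] at * <;> omega

theorem count_factorPath {t : OpTree Unit} (h : IsFactor t) (b : Bool) :
    (factorPath t).count b = t.numLeaves := by
  induction h with
  | prec h =>
    have := count_precPath h b
    rw [factorPath_of_isPrec h]
    cases b <;> simp at * <;> omega
  | @succ t c _ hc ih =>
    have := count_succPath hc b
    cases b <;> simp [factorPath, numLeaves] at * <;> omega

theorem count_normalPath {t : OpTree Unit} (h : IsNormal t) (b : Bool) :
    (normalPath t).count b + 1 = t.numLeaves := by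
  induction h with
  | succ h => rw [normalPath_of_isSucc h, count_succPath h]
  | prec _ hb ih =>
    have := count_factorPath hb b
    simp [normalPath, numLeaves]; omega

end OpTree

/-! ### From balanced paths to words of weight `-1` -/

namespace DiffWord

/-- The numbers of letters `true` between consecutive letters `false`, the first of them
increased by `n`. -/
def ofPath (n : ℕ) : List Bool → List ℕ
  | [] => [n]
  | false :: l => n :: ofPath 0 l
  | true :: l => ofPath (n + 1) l

theorem length_ofPath (n : ℕ) (l : List Bool) : (ofPath n l).length = l.count false + 1 := by
  induction l generalizing n with
  | nil => rfl
  | cons b l ih => cases b <;> simp [ofPath, ih]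

theorem sum_ofPath (n : ℕ) (l : List Bool) : (ofPath n l).sum = n + l.count true := by
  induction l generalizing n with
  | nil => simp [ofPath]
  | cons b l ih => cases b <;> simp [ofPath, ih]; omega

theorem exists_ofPath_eq_cons (n : ℕ) (l : List Bool) :
    ∃ m u, n ≤ m ∧ ofPath n l = m :: u := by
  induction l generalizing n with
  | nil => exact ⟨n, [], le_rfl, rfl⟩
  | cons b l ih =>
    cases b
    · exact ⟨n, _, le_rfl, rfl⟩
    · obtain ⟨m, u, h, h'⟩ := ih (n + 1)
      exact ⟨m, u, by omega, h'⟩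

/-- The first letter exceeds `n` exactly when the path starts with `true`; a path starting with
`false` differs from the empty one by having further letters. -/
theorem ofPath_injective (n : ℕ) : Function.Injective (ofPath n) := by
  intro l l' h
  induction l generalizing n l' with
  | nil =>
    rcases l' with _ | ⟨_ | _, l'⟩
    · rfl
    · obtain ⟨m, u, -, h'⟩ := exists_ofPath_eq_cons 0 l'
      simp [ofPath, h'] at h
    · obtain ⟨m, u, hm, h'⟩ := exists_ofPath_eq_cons (n + 1) l'
      simp [ofPath, h'] at h
      omega
  | cons b l ih =>
    cases b
    · rcases l' with _ | ⟨_ | _, l'⟩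
      · obtain ⟨m, u, -, h'⟩ := exists_ofPath_eq_cons 0 l
        simp [ofPath, h'] at h
      · simp only [ofPath, List.cons.injEq, true_and] at h
        rw [ih 0 h]
      · obtain ⟨m, u, hm, h'⟩ := exists_ofPath_eq_cons (n + 1) l'
        simp [ofPath, h'] at h
        omega
    · rcases l' with _ | ⟨_ | _, l'⟩
      · obtain ⟨m, u, hm, h'⟩ := exists_ofPath_eq_cons (n + 1) l
        simp [ofPath, h'] at h
        omega
      · obtain ⟨m, u, hm, h'⟩ := exists_ofPath_eq_cons (n + 1) l
        simp [ofPath, h'] at h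
        omega
      · simp only [ofPath] at h
        rw [ih (n + 1) h]

/-- The word of weight `-1` that encodes a normal tree. -/
def normalWord (t : OpTree Unit) : List ℕ := ofPath 0 t.normalPath

theorem length_normalWord {t : OpTree Unit} (h : t.IsNormal) :
    (normalWord t).length = t.numLeaves := by
  rw [normalWord, length_ofPath, OpTree.count_normalPath h]

theorem wt_normalWord {t : OpTree Unit} (h : t.IsNormal) : wt (normalWord t) = -1 := by
  have h1 := OpTree.count_normalPath h true
  have h2 := OpTree.count_normalPath h false
  rw [wt_eq_sum, normalWord, length_ofPath, sum_ofPath]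
  push_cast
  omega

theorem normalWord_inj {t t' : OpTree Unit} (ht : t.IsNormal) (ht' : t'.IsNormal)
    (h : normalWord t = normalWord t') : t = t' :=
  OpTree.normalPath_inj ht ht' (ofPath_injective 0 h)

end DiffWord

open OpTree DiffWord NNovAlgebra

noncomputable section

/-! ### The free differential algebra -/

namespace FreeDiff

variable (𝕜 : Type u) (X : Type v) [CommRing 𝕜]

/-- The homomorphism `a ↦ a + ε d(a)`. -/
def derivHom : FreeAlgebra 𝕜 (X × ℕ) →ₐ[𝕜]
    TrivSqZeroExt (FreeAlgebra 𝕜 (X × ℕ)) (FreeAlgebra 𝕜 (X × ℕ)) :=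
  FreeAlgebra.lift 𝕜 fun y => .inl (FreeAlgebra.ι 𝕜 y) + .inr (FreeAlgebra.ι 𝕜 (y.1, y.2 + 1))

/-- Since the first component is the identity, multiplicativity of `derivHom` is the Leibniz rule
for the second. -/
theorem fst_derivHom (a : FreeAlgebra 𝕜 (X × ℕ)) : (derivHom 𝕜 X a).fst = a := by
  have : (TrivSqZeroExt.fstHom 𝕜 _ _).comp (derivHom 𝕜 X) = AlgHom.id 𝕜 _ := by
    ext y
    simp [derivHom]
  exact DFunLike.congr_fun this a

/-- The derivation of the free associative algebra on the letters `x^(n)` that maps `x^(n)` to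
`x^(n+1)`. -/
def deriv : FreeAlgebra 𝕜 (X × ℕ) →ₗ[𝕜] FreeAlgebra 𝕜 (X × ℕ) where
  toFun a := (derivHom 𝕜 X a).snd
  map_add' a b := by simp
  map_smul' r a := by simp

theorem deriv_ι (x : X) (n : ℕ) :
    deriv 𝕜 X (FreeAlgebra.ι 𝕜 (x, n)) = FreeAlgebra.ι 𝕜 (x, n + 1) := by
  simp [deriv, derivHom]

theorem deriv_mul (a b : FreeAlgebra 𝕜 (X × ℕ)) :
    deriv 𝕜 X (a * b) = deriv 𝕜 X a * b + a * deriv 𝕜 X b := by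
  change (derivHom 𝕜 X (a * b)).snd = (derivHom 𝕜 X a).snd * b + a * (derivHom 𝕜 X b).snd
  simp [fst_derivHom, add_comm]

theorem pow_deriv_ι (x : X) (n : ℕ) :
    (deriv 𝕜 X ^ n) (FreeAlgebra.ι 𝕜 (x, 0)) = FreeAlgebra.ι 𝕜 (x, n) := by
  induction n with
  | zero => rfl
  | succ n ih => rw [pow_succ', Module.End.mul_apply, ih, deriv_ι]

theorem basisFreeMonoid_ofList (w : List (X × ℕ)) :
    FreeAlgebra.basisFreeMonoid 𝕜 (X × ℕ) (FreeMonoid.ofList w) =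
      (w.map (FreeAlgebra.ι 𝕜)).prod := by
  have : (w.map (FreeAlgebra.ι 𝕜)).prod =
      FreeAlgebra.equivMonoidAlgebraFreeMonoid.symm
        (MonoidAlgebra.of 𝕜 (FreeMonoid (X × ℕ)) (FreeMonoid.ofList w)) := by
    simp [FreeAlgebra.equivMonoidAlgebraFreeMonoid, FreeMonoid.lift_ofList]
  rw [this]
  rfl

theorem diffMon_ι (w : List (X × ℕ)) :
    diffMon (deriv 𝕜 X) (w.map Prod.snd) (w.map fun y => FreeAlgebra.ι 𝕜 (y.1, 0)) =
      FreeAlgebra.basisFreeMonoid 𝕜 (X × ℕ) (FreeMonoid.ofList w) := by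
  rw [basisFreeMonoid_ofList]
  induction w with
  | nil => simp [diffMon]
  | cons y w ih => rw [List.map_cons, List.map_cons, diffMon_cons, pow_deriv_ι, ih]; simp

end FreeDiff

/-- A differential algebra is a noncommutative Novikov algebra with respect to
`a ≺ b = a d(b)` and `a ≻ b = d(a) b`. -/
abbrev NNovAlgebra.ofDeriv {𝕜 : Type u} {D : Type v} [CommRing 𝕜] [Ring D] [Algebra 𝕜 D]
    (d : D →ₗ[𝕜] D) (hd : ∀ x y : D, d (x * y) = d x * y + x * d y) : NNovAlgebra 𝕜 D where
  prec := (LinearMap.mul 𝕜 D).compl₂ d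
  succ := LinearMap.mul 𝕜 D ∘ₗ d
  succ_prec a b c := by simp [mul_assoc]
  prec_succ a b c := by simp [hd]; noncomm_ring

theorem OpTree.eval_ofDeriv {𝕜 : Type u} {D : Type v} {X : Type w} [CommRing 𝕜] [Ring D]
    [Algebra 𝕜 D] (d : D →ₗ[𝕜] D) (hd : ∀ x y : D, d (x * y) = d x * y + x * d y) (f : X → D)
    (t : OpTree X) :
    letI := NNovAlgebra.ofDeriv d hd
    t.eval 𝕜 f = diffEval d t.shape (t.leaves.map f) := by
  have hl : ∀ t : OpTree X, t.shape.numLeaves = (t.leaves.map f).length := fun t => by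
    rw [shape, numLeaves_map, List.length_map, length_leaves]
  induction t with
  | leaf x => rfl
  | prec l r ihl ihr =>
    simp only [OpTree.eval, ihl, ihr]
    change _ = diffEval d (.prec l.shape r.shape) ((l.leaves ++ r.leaves).map f)
    rw [diffEval, List.map_append, hl, List.take_left, List.drop_left]
    rfl
  | succ l r ihl ihr =>
    simp only [OpTree.eval, ihl, ihr]
    change _ = diffEval d (.succ l.shape r.shape) ((l.leaves ++ r.leaves).map f)
    rw [diffEval, List.map_append, hl, List.take_left, List.drop_left]
    rfl

theorem exists_linearMap_monomial (𝕜 : Type u) {D : Type w} {X : Type v} [CommRing 𝕜] [Ring D]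
    [Algebra 𝕜 D] (d : D →ₗ[𝕜] D) (hd : ∀ x y : D, d (x * y) = d x * y + x * d y) (f : X → D) :
    ∃ φ : FreeNNov 𝕜 X →ₗ[𝕜] D, ∀ t : OpTree X,
      φ (FreeNNov.monomial 𝕜 t) = diffEval d t.shape (t.leaves.map f) := by
  let _ := NNovAlgebra.ofDeriv d hd
  obtain ⟨φ, ⟨h1, h2, h3⟩, -⟩ := FreeNNov.existsUnique_hom 𝕜 f
  refine ⟨φ, fun t => ?_⟩
  rw [← OpTree.eval_ofDeriv d hd, FreeNNov.monomial]
  induction t with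
  | leaf x => exact h1 x
  | prec s t ihs iht => simp only [OpTree.eval, h2, ihs, iht]
  | succ s t ihs iht => simp only [OpTree.eval, h3, ihs, iht]

/-- Vectors with distinct leading terms, each with coefficient one, are independent. -/
theorem linearIndependent_of_leading {R M J ι κ : Type*} [CommRing R] [AddCommGroup M]
    [Module R M] [LinearOrder κ] (b : Module.Basis J R M) (r : J → κ) (v : ι → M) (g : ι → J)
    (hg : Function.Injective g)
    (h : ∀ i, v i - b (g i) ∈ Submodule.span R {y | ∃ j, r j < r (g i) ∧ y = b j}) :
    LinearIndependent R v := by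
  classical
  -- At indices of rank at least `r (g i)`, only the leading term of `v i` is visible. The rank need
  -- not be injective; in the application it ignores the labels in `X`.
  have hcoord : ∀ i j, r (g i) ≤ r j → b.repr (v i) j = if g i = j then 1 else 0 := by
    intro i j hij
    have h0 : v i - b (g i) ∈ LinearMap.ker (b.coord j) := by
      refine Submodule.span_le.2 ?_ (h i)
      rintro _ ⟨k, hk, rfl⟩
      have : k ≠ j := by
        rintro rfl
        exact absurd hk (not_lt.2 hij)
      simp [this]
    rw [LinearMap.mem_ker, map_sub, sub_eq_zero] at h0
    simpa [Finsupp.single_apply] using h0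
  rw [linearIndependent_iff]
  intro l hl
  by_contra hne
  obtain ⟨i, hi, hmax⟩ := l.support.exists_max_image (fun i => r (g i))
    (Finsupp.support_nonempty_iff.2 hne)
  have h1 := congrArg (b.coord (g i)) hl
  rw [Finsupp.linearCombination_apply, Finsupp.sum, map_sum, map_zero,
    Finset.sum_eq_single_of_mem i hi] at h1
  · simp [hcoord i (g i) le_rfl] at h1
    simp [h1] at hi
  · intro k hk hki
    simp [hcoord k (g i) (hmax k hk), hg.ne hki]

/-! ### The basis -/

theorem OpTree.exists_relabel {X : Type v} (s : OpTree Unit) (L : List X)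
    (h : L.length = s.numLeaves) : ∃ t : OpTree X, t.shape = s ∧ t.leaves = L := by
  induction s generalizing L with
  | leaf x =>
    obtain ⟨y, rfl⟩ := List.length_eq_one_iff.1 h
    exact ⟨.leaf y, rfl, rfl⟩
  | prec l r ihl ihr =>
    simp only [numLeaves] at h
    obtain ⟨t₁, h₁, h₁'⟩ := ihl (L.take l.numLeaves) (by simp; omega)
    obtain ⟨t₂, h₂, h₂'⟩ := ihr (L.drop l.numLeaves) (by simp; omega)
    exact ⟨.prec t₁ t₂, congrArg₂ _ h₁ h₂, by simp [leaves, h₁', h₂']⟩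
  | succ l r ihl ihr =>
    simp only [numLeaves] at h
    obtain ⟨t₁, h₁, h₁'⟩ := ihl (L.take l.numLeaves) (by simp; omega)
    obtain ⟨t₂, h₂, h₂'⟩ := ihr (L.drop l.numLeaves) (by simp; omega)
    exact ⟨.succ t₁ t₂, congrArg₂ _ h₁ h₂, by simp [leaves, h₁', h₂']⟩

/-- The words of weight `-1` in the derivatives of the letters of `X`. -/
abbrev LabelledWord (X : Type v) : Type v := {w : List (X × ℕ) // wt (w.map Prod.snd) = -1}

namespace LabelledWord

variable {X : Type v}

theorem exists_tree (w : LabelledWord X) :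
    ∃ t : OpTree X, t.shape = bracket (w.1.map Prod.snd) ∧ t.leaves = w.1.map Prod.fst :=
  OpTree.exists_relabel _ _ (by rw [numLeaves_bracket _ w.2]; simp)

/-- The standard bracketing of a labelled word. -/
def tree (w : LabelledWord X) : OpTree X := w.exists_tree.choose

theorem shape_tree (w : LabelledWord X) : w.tree.shape = bracket (w.1.map Prod.snd) :=
  w.exists_tree.choose_spec.1

theorem leaves_tree (w : LabelledWord X) : w.tree.leaves = w.1.map Prod.fst :=
  w.exists_tree.choose_spec.2

theorem linearIndependent_monomial (𝕜 : Type u) [CommRing 𝕜] (X : Type v) :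
    LinearIndependent 𝕜 fun w : LabelledWord X => FreeNNov.monomial 𝕜 w.tree := by
  obtain ⟨φ, hφ⟩ := exists_linearMap_monomial 𝕜 (FreeDiff.deriv 𝕜 X) (FreeDiff.deriv_mul 𝕜 X)
    fun x => FreeAlgebra.ι 𝕜 (x, 0)
  refine LinearIndependent.of_comp φ ?_
  refine linearIndependent_of_leading (FreeAlgebra.basisFreeMonoid 𝕜 (X × ℕ))
    (fun w => code [] (w.toList.map Prod.snd)) _ (fun w => FreeMonoid.ofList w.1)
    (fun w w' h => Subtype.ext (FreeMonoid.ofList.injective h)) fun w => ?_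
  have h := diffEval_bracket_sub_mem (FreeDiff.deriv_mul 𝕜 X) (w.1.map Prod.snd) w.2
    (w.1.map fun y => FreeAlgebra.ι 𝕜 (y.1, 0)) (by simp)
  rw [FreeDiff.diffMon_ι] at h
  rw [Function.comp_apply, hφ, shape_tree, leaves_tree, List.map_map]
  refine Submodule.span_mono ?_ h
  rintro _ ⟨z, hzl, hz, rfl⟩
  -- Lower words keep the letters of `w` in place and change only the orders of derivation, so
  -- zipping recovers them as labelled words.
  have h1 : ((w.1.map Prod.fst).zip z).map Prod.snd = z :=
    List.map_snd_zip (by simpa using hzl.le)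
  have h2 : ((w.1.map Prod.fst).zip z).map (fun y => FreeAlgebra.ι 𝕜 (y.1, 0)) =
      w.1.map fun y => FreeAlgebra.ι 𝕜 (y.1, 0) := by
    have := List.map_fst_zip (l₁ := w.1.map Prod.fst) (l₂ := z) (by simpa using hzl.ge)
    have := congrArg (List.map fun x => FreeAlgebra.ι 𝕜 (x, 0)) this
    simpa [Function.comp_def] using this
  refine ⟨FreeMonoid.ofList ((w.1.map Prod.fst).zip z), ?_, ?_⟩
  · simpa [h1] using hz.code_lt
  · rw [← FreeDiff.diffMon_ι, h1, h2]

theorem finite_setOf_wt (k : ℕ) : {u : List ℕ | wt u = -1 ∧ u.length = k}.Finite := by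
  refine (Set.finite_range fun g : Fin k → Fin (k + 1) => List.ofFn fun i => (g i : ℕ)).subset ?_
  rintro u ⟨hu, rfl⟩
  rw [wt_eq_sum] at hu
  refine ⟨fun i => ⟨u[i], ?_⟩, by simp⟩
  have := List.single_le_sum (l := u) (fun _ _ => Nat.zero_le _) u[i] (List.getElem_mem _)
  omega

/-- Fix the leaves of `t`. The bracketings labelled by them are independent, are indexed by `U`, and
lie in the span of the normal trees `N` with `|N| ≤ |U|`; over a field the two spans then coincide.
-/
theorem monomial_mem_span (𝕜 : Type u) [Field 𝕜] (t : OpTree X) :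
    FreeNNov.monomial 𝕜 t ∈
      Submodule.span 𝕜 (Set.range fun w : LabelledWord X => FreeNNov.monomial 𝕜 w.tree) := by
  set U : Set (List ℕ) := {u | wt u = -1 ∧ u.length = t.leaves.length}
  have hUf : U.Finite := finite_setOf_wt _
  let N : Set (OpTree X) := {s | s.IsNormal ∧ s.leaves = t.leaves}
  have hinj : Set.InjOn (fun s : OpTree X => normalWord s.shape) N := by
    rintro s ⟨hs, hs'⟩ s' ⟨ht, ht'⟩ h
    exact OpTree.eq_of_shape_eq (normalWord_inj hs.shape ht.shape h) (hs'.trans ht'.symm)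
  have hmaps : ∀ s ∈ N, normalWord s.shape ∈ U := by
    rintro s ⟨hs, hs'⟩
    refine ⟨wt_normalWord hs.shape, ?_⟩
    rw [length_normalWord hs.shape, shape, numLeaves_map, ← length_leaves, hs']
  have hNf : N.Finite := Set.Finite.of_injOn hmaps hinj hUf
  have hcard : N.ncard ≤ U.ncard := Set.ncard_le_ncard_of_injOn _ hmaps hinj hUf
  have hspan : treeSpan 𝕜 (FreeNNov.of 𝕜) IsNormal t.leaves =
      Submodule.span 𝕜 (FreeNNov.monomial 𝕜 '' N) := by
    rw [treeSpan]
    congr 1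
    ext y
    constructor
    · rintro ⟨s, h1, h2, rfl⟩
      exact ⟨s, ⟨h1, h2⟩, rfl⟩
    · rintro ⟨s, ⟨h1, h2⟩, rfl⟩
      exact ⟨s, h1, h2, rfl⟩
  let e : U → LabelledWord X := fun u => ⟨t.leaves.zip u.1, by
    rw [List.map_snd_zip u.2.2.le]; exact u.2.1⟩
  have he : Function.Injective e := by
    intro u u' h
    have h1 := congrArg (List.map Prod.snd) (congrArg Subtype.val h)
    simp only [e] at h1
    rw [List.map_snd_zip u.2.2.le, List.map_snd_zip u'.2.2.le] at h1
    exact Subtype.ext h1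
  have hle : Submodule.span 𝕜 (Set.range fun u : U => FreeNNov.monomial 𝕜 (e u).tree) ≤
      treeSpan 𝕜 (FreeNNov.of 𝕜) IsNormal t.leaves := by
    refine Submodule.span_le.2 ?_
    rintro _ ⟨u, rfl⟩
    have := eval_mem_treeSpan_isNormal 𝕜 (FreeNNov.of 𝕜) (e u).tree
    rw [leaves_tree] at this
    simp only [e] at this
    rwa [List.map_fst_zip u.2.2.ge] at this
  have : Fintype U := hUf.fintype
  have : Fintype (FreeNNov.monomial 𝕜 '' N) := (hNf.image _).fintype
  have : FiniteDimensional 𝕜 (treeSpan 𝕜 (FreeNNov.of 𝕜) IsNormal t.leaves) := by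
    rw [hspan]
    exact FiniteDimensional.span_of_finite 𝕜 (hNf.image _)
  have heq := Submodule.eq_of_le_of_finrank_le hle (by
    have hli : LinearIndependent 𝕜 fun u : U => FreeNNov.monomial 𝕜 (e u).tree :=
      (linearIndependent_monomial 𝕜 X).comp e he
    rw [finrank_span_eq_card hli, hspan]
    refine (finrank_span_le_card _).trans ?_
    rw [← Set.ncard_eq_toFinset_card', ← Nat.card_eq_fintype_card]
    exact (Set.ncard_image_le hNf).trans hcard)
  have hmem : FreeNNov.monomial 𝕜 t ∈ treeSpan 𝕜 (FreeNNov.of 𝕜) IsNormal t.leaves :=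
    eval_mem_treeSpan_isNormal 𝕜 (FreeNNov.of 𝕜) t
  rw [← heq] at hmem
  refine Submodule.span_mono ?_ hmem
  rintro _ ⟨u, rfl⟩
  exact ⟨e u, rfl⟩

theorem span_monomial (𝕜 : Type u) [Field 𝕜] (X : Type v) :
    ⊤ ≤ Submodule.span 𝕜 (Set.range fun w : LabelledWord X => FreeNNov.monomial 𝕜 w.tree) := by
  rintro y -
  induction y using Submodule.Quotient.induction_on with | _ y => ?_
  induction y using Finsupp.induction_linear with
  | zero => exact zero_mem _
  | add a b ha hb => exact add_mem ha hb
  | single t r =>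
    have : (Submodule.Quotient.mk (Finsupp.single t r) : FreeNNov 𝕜 X) =
        r • FreeNNov.monomial 𝕜 t := by
      rw [FreeNNov.monomial, ← FreeNNov.mk_tree, ← Submodule.Quotient.mk_smul]
      simp
    rw [this]
    exact Submodule.smul_mem _ _ (monomial_mem_span 𝕜 t)

/-- Independence already separates the bracketings, so no combinatorial inverse is constructed. -/
theorem tree_injective (𝕜 : Type u) [Field 𝕜] (X : Type v) :
    Function.Injective (tree : LabelledWord X → OpTree X) := fun _ _ h =>
  (linearIndependent_monomial 𝕜 X).injective (congrArg (FreeNNov.monomial 𝕜) h)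

theorem range_tree (X : Type v) :
    Set.range (tree : LabelledWord X → OpTree X) = labelledBracketSet X := by
  ext t
  constructor
  · rintro ⟨w, rfl⟩
    exact ⟨_, w.2, w.shape_tree.symm⟩
  · rintro ⟨u, hu, hb⟩
    have hl : u.length = t.leaves.length := by
      rw [← numLeaves_bracket u hu, hb, shape, numLeaves_map, length_leaves]
    have h1 : (t.leaves.zip u).map Prod.snd = u := List.map_snd_zip hl.le
    refine ⟨⟨t.leaves.zip u, by rw [h1, hu]⟩, OpTree.eq_of_shape_eq ?_ ?_⟩
    · rw [shape_tree, h1, hb]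
    · rw [leaves_tree]
      exact List.map_fst_zip hl.ge

end LabelledWord

end

theorem mainTheorem2 (𝕜 : Type u) [Field 𝕜] (X : Type v) :
    ∃ b : Module.Basis (labelledBracketSet X) 𝕜 (FreeNNov 𝕜 X),
      ∀ t : labelledBracketSet X, b t = FreeNNov.monomial 𝕜 (t : OpTree X) := by
  let e : LabelledWord X ≃ labelledBracketSet X :=
    (Equiv.ofInjective _ (LabelledWord.tree_injective 𝕜 X)).trans
      (Equiv.setCongr (LabelledWord.range_tree X))
  refine ⟨(Module.Basis.mk (LabelledWord.linearIndependent_monomial 𝕜 X)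
    (LabelledWord.span_monomial 𝕜 X)).reindex e, fun t => ?_⟩
  obtain ⟨w, rfl⟩ := e.surjective t
  rw [Module.Basis.reindex_apply, Equiv.symm_apply_apply, Module.Basis.mk_apply]
  rfl
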